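/- **Theorem (bivariate distribution of the fractional Poisson process).** Let $\lambda>0$ and $0<\nu\le 1$. For real $\alpha,\eta,\gamma>0$ and $z\in\mathbb{R}$ let $$E^{\gamma}_{\alpha,\eta}(z)=\sum_{j=0}^{\infty}\frac{\Gamma(\gamma+j)\,z^{j}}{j!\,\Gamma(\gamma)\,\Gamma(\alpha j+\eta)},\qquad E_{\alpha,\eta}(z)=E^{1}_{\alpha,\eta}(z),$$ be the generalised (Prabhakar) Mittag-Leffler function. Let $N^{\nu}(t)$, $t\ge 0$, be the fractional Poisson process, i.e. the renewal process $N^\nu(t)=\#\{n\ge 1: J_1+\dots+J_n\le t\}$ whose interarrival times $J_1,J_2,\dots$ are independent with common law $\Pr\{J_i\in \mathrm dx\}=\lambda x^{\nu-1}E_{\nu,\nu}(-\lambda x^{\nu})\,\mathrm dx$ on $(0,\infty)$. Then for all $0\le s\le t$ and all integers $1\le k<r$, $$\Pr\{N^{\nu}(s)=k,\,N^{\nu}(t)=r\}=\lambda^{r}\int_{0}^{s}w^{\nu k-1}E^{k}_{\nu,\nu k}(-\lambda w^{\nu})\int_{s-w}^{t-w}y^{\nu-1}E_{\nu,\nu}(-\lambda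 y^{\nu})\,(t-w-y)^{\nu(r-k-1)}E^{r-k}_{\nu,\nu(r-k-1)+1}\bigl(-\lambda(t-w-y)^{\nu}\bigr)\,\mathrm dy\,\mathrm dw,$$ where all the integrals converge absolutely. -/

import Mathlib

open MeasureTheory ProbabilityTheory

/-- The generalised (Prabhakar) Mittag-Leffler function `E^γ_{α,η}(z)` for real parameters
`α, η, γ > 0` and real argument `z`:
the sum over `j ≥ 0` of `Γ(γ + j) z^j / (j! Γ(γ) Γ(α j + η))`. -/
noncomputable def prabhakar (γ α η z : ℝ) : ℝ :=
  ∑' j : ℕ, Real.Gamma (γ + j) * z ^ j /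
    ((j.factorial : ℝ) * Real.Gamma γ * Real.Gamma (α * j + η))

/-- The two-parameter Mittag-Leffler function `E_{α,η}(z) = E^1_{α,η}(z)`. -/
noncomputable def mittagLeffler (α η z : ℝ) : ℝ :=
  prabhakar 1 α η z

/-- The Mittag-Leffler interarrival law on `(0, ∞)`, with Lebesgue density
`x ↦ lam x^(ν-1) E_{ν,ν}(-lam x^ν)`. -/
noncomputable def mittagLefflerLaw (lam ν : ℝ) : Measure ℝ :=
  (volume.restrict (Set.Ioi (0 : ℝ))).withDensity
    (fun x => ENNReal.ofReal (lam * x ^ (ν - 1) * mittagLeffler ν ν (-lam * x ^ ν)))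

/-- The instant `T_n = J_0 + ... + J_{n-1}` of the `n`-th event, for interarrival times `J`. -/
def eventTime {Ω : Type*} (J : ℕ → Ω → ℝ) (n : ℕ) (ω : Ω) : ℝ :=
  ∑ i ∈ Finset.range n, J i ω

/-- `N` (a family indexed by the times `t ≥ 0`) is a fractional Poisson process with rate `lam`
and index `ν`: the renewal counting process of independent interarrival times that all have the
Mittag-Leffler law, that is, almost surely, for every `t ≥ 0`, `N t` is the number of `n ≥ 1`
with `T_n ≤ t`. The count is taken in `ℕ∞`, so that it is finite wherever it equals `N t`. -/
def IsFractionalPoissonProcess {Ω : Type*} [MeasurableSpace Ω] (lam ν : ℝ)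
    (N : ℝ → Ω → ℕ) (P : Measure Ω) : Prop :=
  ∃ J : ℕ → Ω → ℝ,
    iIndepFun J P ∧
    (∀ n, HasLaw (J n) (mittagLefflerLaw lam ν) P) ∧
    ∀ᵐ ω ∂P, ∀ t : ℝ, 0 ≤ t →
      (N t ω : ℕ∞) = Set.encard {n : ℕ | 1 ≤ n ∧ eventTime J n ω ≤ t}

/-!
The functions `x ^ (η - 1) * E^d_{ν, η}(-lam * x ^ ν)` are power series in the fractional
integration operator of order `ν`, applied to a power of `x`; their additive convolution therefore
corresponds to the product of the power series, here `(1 + lam * X)⁻¹ ^ d`. Hence the convolution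
powers of the Mittag-Leffler law, and the counting probabilities `P{N u = m}`, again have Prabhakar
form. Nonnegativity for `ν ≤ 1` comes from the extremum principle of fractional calculus. The joint
probability is found by conditioning first on the time `w` of the `k`-th event, after which the
process starts afresh, and then on the waiting time `y` for the next event, which has to fall in
`(s - w, t - w]`.
-/

theorem rpow_mul_exp_neg_le_Gamma_add_one {A x : ℝ} (hA : 0 < A) (hx : 0 < x) :
    A ^ x * Real.exp (-A) ≤ Real.Gamma (x + 1) := by
  have hint := Real.GammaIntegral_convergent (s := x + 1) (by linarith)
  have hsub : Set.Ioi A ⊆ Set.Ioi (0 : ℝ) := Set.Ioi_subset_Ioi hA.le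
  rw [Real.Gamma_eq_integral (by linarith)]
  calc A ^ x * Real.exp (-A) = ∫ y in Set.Ioi A, A ^ x * Real.exp (-y) := by
        rw [integral_const_mul, integral_exp_neg_Ioi]
    _ ≤ ∫ y in Set.Ioi A, Real.exp (-y) * y ^ (x + 1 - 1) := by
        refine setIntegral_mono_on ((integrableOn_exp_neg_Ioi A).const_mul _)
          (hint.mono_set hsub) measurableSet_Ioi fun y hy => ?_
        rw [mul_comm, add_sub_cancel_right]
        gcongr
        exact le_of_lt hy
    _ ≤ ∫ y in Set.Ioi 0, Real.exp (-y) * y ^ (x + 1 - 1) := by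
        refine setIntegral_mono_set hint ?_ hsub.eventuallyLE
        filter_upwards [ae_restrict_mem measurableSet_Ioi] with y hy
        exact mul_nonneg (Real.exp_pos _).le (Real.rpow_nonneg (le_of_lt hy) _)

theorem rpow_mul_exp_neg_le_Gamma {B x : ℝ} (hB : 0 < B) (hx : 0 < x) :
    B ^ x * Real.exp (-(Real.exp 1 * B)) ≤ Real.Gamma x := by
  have hGamma := rpow_mul_exp_neg_le_Gamma_add_one (mul_pos (Real.exp_pos 1) hB) hx
  rw [Real.Gamma_add_one hx.ne', Real.mul_rpow (Real.exp_pos 1).le hB.le,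
    Real.exp_one_rpow, mul_assoc] at hGamma
  have hexp : x ≤ Real.exp x := by linarith [Real.add_one_le_exp x]
  refine le_of_mul_le_mul_left (le_trans ?_ hGamma) hx
  gcongr

/-- The sequence `h` tends to zero faster than every geometric sequence. -/
def SuperexponentialDecay (h : ℕ → ℝ) : Prop :=
  ∀ ε : ℝ, 0 < ε → ∃ K : ℝ, ∀ n : ℕ, |h n| ≤ K * ε ^ n

namespace SuperexponentialDecay

theorem const_mul {h : ℕ → ℝ} (hh : SuperexponentialDecay h) (c : ℝ) :
    SuperexponentialDecay fun n => c * h n := by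
  intro ε hε
  obtain ⟨K, hK⟩ := hh ε hε
  refine ⟨|c| * K, fun n => ?_⟩
  rw [abs_mul, mul_assoc]
  gcongr
  exact hK n

theorem pow_mul {h : ℕ → ℝ} (hh : SuperexponentialDecay h) (z : ℝ) :
    SuperexponentialDecay fun n => z ^ n * h n := by
  intro ε hε
  obtain ⟨K, hK⟩ := hh (ε / (|z| + 1)) (by positivity)
  refine ⟨K, fun n => ?_⟩
  calc |z ^ n * h n| ≤ (|z| + 1) ^ n * (K * (ε / (|z| + 1)) ^ n) := by
        rw [abs_mul, abs_pow]
        have := hK n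
        gcongr
        linarith
    _ = K * ε ^ n := by
        rw [mul_left_comm, ← mul_pow, mul_div_cancel₀ ε (by positivity)]

theorem inv_Gamma {ν η : ℝ} (hν : 0 < ν) (hη : 0 < η) :
    SuperexponentialDecay fun n => (Real.Gamma (ν * n + η))⁻¹ := by
  intro ε hε
  set B : ℝ := ε ^ (-ν⁻¹) with hB
  have hB0 : 0 < B := by positivity
  have hBν : B ^ ν = ε⁻¹ := by
    rw [hB, ← Real.rpow_mul hε.le, neg_mul, inv_mul_cancel₀ hν.ne', Real.rpow_neg_one]
  refine ⟨(B ^ η * Real.exp (-(Real.exp 1 * B)))⁻¹, fun n => ?_⟩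
  have hx : 0 < ν * n + η := by positivity
  rw [abs_of_pos (inv_pos.2 (Real.Gamma_pos_of_pos hx))]
  calc (Real.Gamma (ν * n + η))⁻¹
      ≤ (B ^ (ν * n + η) * Real.exp (-(Real.exp 1 * B)))⁻¹ :=
        inv_anti₀ (by positivity) (rpow_mul_exp_neg_le_Gamma hB0 hx)
    _ = (B ^ η * Real.exp (-(Real.exp 1 * B)))⁻¹ * ε ^ n := by
        rw [Real.rpow_add hB0, Real.rpow_mul hB0.le, hBν, Real.rpow_natCast, inv_pow]
        simp only [mul_inv, inv_inv]
        ring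

end SuperexponentialDecay

/-- The Riemann–Liouville kernel `x ^ (a - 1) / Γ(a)`, convolution with which is the fractional
integral of order `a`. -/
noncomputable def riemannLiouvilleKernel (a x : ℝ) : ℝ :=
  x ^ (a - 1) / Real.Gamma a

theorem riemannLiouvilleKernel_nonneg {a x : ℝ} (ha : 0 ≤ a) (hx : 0 ≤ x) :
    0 ≤ riemannLiouvilleKernel a x :=
  div_nonneg (Real.rpow_nonneg hx _) (Real.Gamma_nonneg_of_nonneg ha)

theorem riemannLiouvilleKernel_pos {a x : ℝ} (ha : 0 < a) (hx : 0 < x) :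
    0 < riemannLiouvilleKernel a x :=
  div_pos (Real.rpow_pos_of_pos hx _) (Real.Gamma_pos_of_pos ha)

theorem riemannLiouvilleKernel_one (x : ℝ) : riemannLiouvilleKernel 1 x = 1 := by
  simp [riemannLiouvilleKernel]

theorem riemannLiouvilleKernel_mul_add {ν x : ℝ} (η : ℝ) (n : ℕ) (hx : 0 < x) :
    riemannLiouvilleKernel (ν * n + η) x =
      x ^ (η - 1) * ((x ^ ν) ^ n * (Real.Gamma (ν * n + η))⁻¹) := by
  rw [riemannLiouvilleKernel, add_sub_assoc, Real.rpow_add hx, Real.rpow_mul hx.le,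
    Real.rpow_natCast]
  ring

theorem superexponentialDecay_riemannLiouvilleKernel {ν η x : ℝ} (hν : 0 < ν) (hη : 0 < η)
    (hx : 0 < x) : SuperexponentialDecay fun n => riemannLiouvilleKernel (ν * n + η) x := by
  simp only [riemannLiouvilleKernel_mul_add η _ hx]
  exact ((SuperexponentialDecay.inv_Gamma hν hη).pow_mul _).const_mul _

theorem betaIntegral_ofReal {a b : ℝ} (ha : 0 < a) (hb : 0 < b) :
    Complex.betaIntegral a b = (beta a b : ℝ) := by
  rw [Complex.betaIntegral_eq_Gamma_mul_div _ _ (by simpa) (by simpa), beta]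
  push_cast [← Complex.Gamma_ofReal]
  rfl

theorem integral_rpow_mul_sub_rpow {a b x : ℝ} (ha : 0 < a) (hb : 0 < b) (hx : 0 < x) :
    ∫ y in (0 : ℝ)..x, y ^ (a - 1) * (x - y) ^ (b - 1) = x ^ (a + b - 1) * beta a b := by
  apply Complex.ofReal_injective
  rw [← intervalIntegral.integral_ofReal, Complex.ofReal_mul, ← betaIntegral_ofReal ha hb,
    Complex.ofReal_cpow hx.le]
  push_cast
  rw [← Complex.betaIntegral_scaled a b hx]
  refine intervalIntegral.integral_congr fun y hy => ?_
  rw [Set.uIcc_of_le hx.le] at hy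
  simp only [Complex.ofReal_cpow hy.1, Complex.ofReal_cpow (sub_nonneg.2 hy.2),
    Complex.ofReal_sub, Complex.ofReal_one]

theorem integral_riemannLiouvilleKernel_mul {a b x : ℝ} (ha : 0 < a) (hb : 0 < b)
    (hx : 0 < x) :
    ∫ y in (0 : ℝ)..x, riemannLiouvilleKernel a y * riemannLiouvilleKernel b (x - y) =
      riemannLiouvilleKernel (a + b) x := by
  have hGa := (Real.Gamma_pos_of_pos ha).ne'
  have hGb := (Real.Gamma_pos_of_pos hb).ne'
  simp only [riemannLiouvilleKernel, div_mul_div_comm]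
  rw [intervalIntegral.integral_div, integral_rpow_mul_sub_rpow ha hb hx, beta]
  field_simp [hGa, hGb]

theorem intervalIntegrable_riemannLiouvilleKernel_mul {a b x : ℝ} (ha : 0 < a) (hb : 0 < b)
    (hx : 0 < x) : IntervalIntegrable
      (fun y => riemannLiouvilleKernel a y * riemannLiouvilleKernel b (x - y)) volume 0 x := by
  refine intervalIntegral.intervalIntegrable_of_integral_ne_zero ?_
  rw [integral_riemannLiouvilleKernel_mul ha hb hx]
  exact (riemannLiouvilleKernel_pos (add_pos ha hb) hx).ne'

/-- Power series whose coefficients grow at most geometrically. -/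
def GeomBounded (p : PowerSeries ℝ) : Prop :=
  ∃ C R : ℝ, 0 < C ∧ 0 < R ∧ ∀ j : ℕ, |PowerSeries.coeff j p| ≤ C * R ^ j

namespace GeomBounded

theorem one : GeomBounded 1 := by
  refine ⟨1, 1, one_pos, one_pos, fun j => ?_⟩
  rw [PowerSeries.coeff_one]
  split_ifs <;> simp

theorem summable_norm_coeff_mul_coeff_mul {p q : PowerSeries ℝ} {h : ℕ → ℝ}
    (hp : GeomBounded p) (hq : GeomBounded q) (hh : SuperexponentialDecay h) :
    Summable fun ij : ℕ × ℕ =>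
      ‖PowerSeries.coeff ij.1 p * PowerSeries.coeff ij.2 q * h (ij.1 + ij.2)‖ := by
  obtain ⟨C, R, hC, hR, hp⟩ := hp
  obtain ⟨D, S, hD, hS, hq⟩ := hq
  obtain ⟨K, hK⟩ := hh (1 / (R + S)) (by positivity)
  have hgeom : Summable fun ij : ℕ × ℕ => (R / (R + S)) ^ ij.1 * (S / (R + S)) ^ ij.2 :=
    (summable_geometric_of_lt_one (by positivity)
      ((div_lt_one (by positivity)).2 (by linarith))).mul_of_nonneg
      (summable_geometric_of_lt_one (by positivity)
        ((div_lt_one (by positivity)).2 (by linarith)))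
      (fun _ => by positivity) (fun _ => by positivity)
  refine .of_nonneg_of_le (fun _ => norm_nonneg _) (fun ⟨i, j⟩ => ?_)
    (hgeom.mul_left (C * D * K))
  calc ‖PowerSeries.coeff i p * PowerSeries.coeff j q * h (i + j)‖
      ≤ C * R ^ i * (D * S ^ j) * (K * (1 / (R + S)) ^ (i + j)) := by
        rw [norm_mul, norm_mul]
        have := hp i
        have := hq j
        have := hK (i + j)
        simp only [Real.norm_eq_abs]
        gcongr
    _ = C * D * K * ((R / (R + S)) ^ i * (S / (R + S)) ^ j) := by
        rw [pow_add, div_eq_mul_one_div R, div_eq_mul_one_div S, mul_pow, mul_pow]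
        ring

theorem summable_norm_coeff_mul {p : PowerSeries ℝ} {h : ℕ → ℝ}
    (hp : GeomBounded p) (hh : SuperexponentialDecay h) :
    Summable fun j => ‖PowerSeries.coeff j p * h j‖ := by
  simpa [Function.comp_def] using (summable_norm_coeff_mul_coeff_mul hp one hh).comp_injective
    (i := fun j => (j, 0)) fun _ _ hij => congrArg Prod.fst hij

end GeomBounded

theorem tsum_coeff_mul_coeff_mul {p q : PowerSeries ℝ} {h : ℕ → ℝ}
    (hs : Summable fun ij : ℕ × ℕ =>
      PowerSeries.coeff ij.1 p * PowerSeries.coeff ij.2 q * h (ij.1 + ij.2)) :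
    ∑' ij : ℕ × ℕ, PowerSeries.coeff ij.1 p * PowerSeries.coeff ij.2 q * h (ij.1 + ij.2) =
      ∑' n : ℕ, PowerSeries.coeff n (p * q) * h n := by
  have hs' := Finset.HasAntidiagonal.sigmaAntidiagonalEquivProd.summable_iff.2 hs
  rw [← Finset.HasAntidiagonal.sigmaAntidiagonalEquivProd.tsum_eq (_ : ℕ × ℕ → ℝ)]
  refine (hs'.tsum_sigma' fun n => (hasSum_fintype _).summable).trans (tsum_congr fun n => ?_)
  rw [tsum_fintype, PowerSeries.coeff_mul, Finset.sum_mul,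
    ← Finset.sum_coe_sort (Finset.HasAntidiagonal.antidiagonal n)]
  refine Finset.sum_congr rfl fun ij _ => ?_
  have := Finset.HasAntidiagonal.mem_antidiagonal.1 ij.2
  simp [← this]

theorem differentiable_tsum_mul_pow {c : ℕ → ℝ} (hc : ∀ r : ℝ, Summable fun n => |c n| * r ^ n) :
    Differentiable ℝ fun z : ℝ => ∑' n, c n * z ^ n := by
  have hradius : (FormalMultilinearSeries.ofScalars ℝ c).radius = ⊤ :=
    FormalMultilinearSeries.radius_eq_top_of_summable_norm _ fun r => by
      simpa [FormalMultilinearSeries.ofScalars_norm] using hc r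
  have hball := (FormalMultilinearSeries.ofScalars ℝ c).hasFPowerSeriesOnBall
    (by simp [hradius])
  have hdiff := hball.differentiableOn
  rw [hradius, Metric.eball_top, differentiableOn_univ] at hdiff
  rwa [← FormalMultilinearSeries.ofScalarsSum, FormalMultilinearSeries.ofScalarsSum_eq_tsum]
    at hdiff

/-- The series `∑ p_j z^j / Γ(ν j + η)`: the Mittag-Leffler function `E_{ν,η}` for
`p = 1 / (1 - X)`, the Prabhakar function `E^γ_{ν,η}` for `p = (1 - X) ^ (-γ)`. -/
noncomputable def mlSeries (ν : ℝ) (p : PowerSeries ℝ) (η z : ℝ) : ℝ :=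
  ∑' j : ℕ, PowerSeries.coeff j p * (z ^ j * (Real.Gamma (ν * j + η))⁻¹)

/-- The function `x ↦ ∑ p_j x^(ν j + η - 1) / Γ(ν j + η)` on the positive half-line, the
inverse Laplace transform of `z^(-η) p(z^(-ν))`. It is written with the powers of `x^ν` factored
out, so that its regularity is that of the entire function `mlSeries`. -/
noncomputable def mlKernel (ν : ℝ) (p : PowerSeries ℝ) (η x : ℝ) : ℝ :=
  x ^ (η - 1) * mlSeries ν p η (x ^ ν)

theorem mlKernel_one (ν η x : ℝ) : mlKernel ν 1 η x = riemannLiouvilleKernel η x := by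
  rw [mlKernel, mlSeries, tsum_eq_single 0 fun j hj => by simp [PowerSeries.coeff_one, hj],
    riemannLiouvilleKernel]
  simp [div_eq_mul_inv]

theorem mlKernel_eq_tsum (p : PowerSeries ℝ) (ν η : ℝ) {x : ℝ} (hx : 0 < x) :
    mlKernel ν p η x =
      ∑' j : ℕ, PowerSeries.coeff j p * riemannLiouvilleKernel (ν * j + η) x := by
  simp only [mlKernel, mlSeries, ← tsum_mul_left, riemannLiouvilleKernel_mul_add η _ hx,
    mul_left_comm]

theorem mlSeries_zero (ν : ℝ) (p : PowerSeries ℝ) (η : ℝ) :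
    mlSeries ν p η 0 = PowerSeries.coeff 0 p * (Real.Gamma η)⁻¹ := by
  rw [mlSeries, tsum_eq_single 0 fun j hj => by simp [hj]]
  simp

namespace GeomBounded

variable {p q : PowerSeries ℝ} {ν η x : ℝ}

theorem differentiable_mlSeries (hp : GeomBounded p) (hν : 0 < ν) (hη : 0 < η) :
    Differentiable ℝ (mlSeries ν p η) := by
  have hsum (r : ℝ) : Summable fun j : ℕ =>
      |PowerSeries.coeff j p * (Real.Gamma (ν * j + η))⁻¹| * r ^ j := by
    refine Summable.of_norm ?_
    simpa [mul_assoc, mul_comm, mul_left_comm, abs_mul] using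
      hp.summable_norm_coeff_mul ((SuperexponentialDecay.inv_Gamma hν hη).pow_mul r)
  convert differentiable_tsum_mul_pow hsum using 2 with z
  exact tsum_congr fun j => by ring

theorem differentiableAt_mlKernel (hp : GeomBounded p) (hν : 0 < ν) (hη : 0 < η) (hx : 0 < x) :
    DifferentiableAt ℝ (mlKernel ν p η) x :=
  (Real.differentiableAt_rpow_const_of_ne _ hx.ne').mul
    ((hp.differentiable_mlSeries hν hη _).comp x (Real.differentiableAt_rpow_const_of_ne _ hx.ne'))

theorem measurable_mlKernel (hp : GeomBounded p) (hν : 0 < ν) (hη : 0 < η) :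
    Measurable (mlKernel ν p η) := by
  have := (hp.differentiable_mlSeries hν hη).continuous.measurable
  unfold mlKernel
  fun_prop

theorem summable_norm_mlKernel (hp : GeomBounded p) (hν : 0 < ν) (hη : 0 < η) (hx : 0 < x) :
    Summable fun j : ℕ => ‖PowerSeries.coeff j p * riemannLiouvilleKernel (ν * j + η) x‖ :=
  hp.summable_norm_coeff_mul (superexponentialDecay_riemannLiouvilleKernel hν hη hx)

theorem hasSum_mlKernel (hp : GeomBounded p) (hν : 0 < ν) (hη : 0 < η) (hx : 0 < x) :
    HasSum (fun j : ℕ => PowerSeries.coeff j p * riemannLiouvilleKernel (ν * j + η) x)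
      (mlKernel ν p η x) := by
  rw [mlKernel_eq_tsum p ν η hx]
  exact (hp.summable_norm_mlKernel hν hη hx).of_norm.hasSum

end GeomBounded

theorem integrable_and_hasSum_integral_of_summable_integral_norm {α ι : Type*}
    [MeasurableSpace α] {μ : Measure α} [Countable ι] {F : ι → α → ℝ} {f : α → ℝ}
    (hF : ∀ i, Integrable (F i) μ) (hsum : Summable fun i => ∫ a, ‖F i a‖ ∂μ)
    (hf : AEStronglyMeasurable f μ) (hFf : ∀ᵐ a ∂μ, HasSum (fun i => F i a) (f a)) :
    Integrable f μ ∧ HasSum (fun i => ∫ a, F i a ∂μ) (∫ a, f a ∂μ) := by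
  have hae : f =ᵐ[μ] fun a => ∑' i, F i a := hFf.mono fun a ha => ha.tsum_eq.symm
  refine ⟨⟨hf, ?_⟩, integral_congr_ae hae ▸ hasSum_integral_of_summable_integral_norm hF hsum⟩
  calc ∫⁻ a, ‖f a‖ₑ ∂μ ≤ ∫⁻ a, ∑' i, ‖F i a‖ₑ ∂μ :=
        lintegral_mono_ae (hae.mono fun a ha => ha ▸ enorm_tsum_le_tsum_enorm)
    _ = ∑' i, ENNReal.ofReal (∫ a, ‖F i a‖ ∂μ) := by
        rw [lintegral_tsum fun i => (hF i).1.enorm]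
        exact tsum_congr fun i => (ofReal_integral_norm_eq_lintegral_enorm (hF i)).symm
    _ = ENNReal.ofReal (∑' i, ∫ a, ‖F i a‖ ∂μ) :=
        (ENNReal.ofReal_tsum_of_nonneg (fun _ => integral_nonneg fun _ => norm_nonneg _)
          hsum).symm
    _ < ⊤ := ENNReal.ofReal_lt_top

theorem intervalIntegral_eq_integral_Ioo {f : ℝ → ℝ} {a b : ℝ} (hab : a ≤ b) :
    ∫ y in a..b, f y = ∫ y in Set.Ioo a b, f y := by
  rw [intervalIntegral.integral_of_le hab, integral_Ioc_eq_integral_Ioo]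

theorem integral_norm_mul_riemannLiouvilleKernel_mul {a b x : ℝ} (ha : 0 < a) (hb : 0 < b)
    (hx : 0 < x) (c : ℝ) :
    ∫ y in Set.Ioo 0 x, ‖c * (riemannLiouvilleKernel a y * riemannLiouvilleKernel b (x - y))‖ =
      ‖c * riemannLiouvilleKernel (a + b) x‖ := by
  rw [norm_mul, Real.norm_of_nonneg (riemannLiouvilleKernel_nonneg (add_pos ha hb).le hx.le),
    ← integral_riemannLiouvilleKernel_mul ha hb hx, intervalIntegral_eq_integral_Ioo hx.le,
    ← integral_const_mul]
  refine setIntegral_congr_fun measurableSet_Ioo fun y hy => ?_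
  rw [norm_mul, Real.norm_of_nonneg (mul_nonneg (riemannLiouvilleKernel_nonneg ha.le hy.1.le)
    (riemannLiouvilleKernel_nonneg hb.le (sub_nonneg.2 hy.2.le)))]

section Convolution

variable {p q : PowerSeries ℝ} {ν η₁ η₂ x : ℝ}

theorem hasSum_mlKernel_mul_mlKernel (hp : GeomBounded p) (hq : GeomBounded q) (hν : 0 < ν)
    (h₁ : 0 < η₁) (h₂ : 0 < η₂) {y z : ℝ} (hy : 0 < y) (hz : 0 < z) :
    HasSum (fun ij : ℕ × ℕ => PowerSeries.coeff ij.1 p * PowerSeries.coeff ij.2 q *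
        (riemannLiouvilleKernel (ν * ij.1 + η₁) y * riemannLiouvilleKernel (ν * ij.2 + η₂) z))
      (mlKernel ν p η₁ y * mlKernel ν q η₂ z) := by
  have hsum := summable_mul_of_summable_norm (hp.summable_norm_mlKernel hν h₁ hy)
    (hq.summable_norm_mlKernel hν h₂ hz)
  simpa only [mul_mul_mul_comm] using
    HasSum.mul (hp.hasSum_mlKernel hν h₁ hy) (hq.hasSum_mlKernel hν h₂ hz) hsum

theorem integrableOn_and_hasSum_integral_mlKernel_mul_mlKernel (hp : GeomBounded p)
    (hq : GeomBounded q) (hν : 0 < ν) (h₁ : 0 < η₁) (h₂ : 0 < η₂) (hx : 0 < x) :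
    IntegrableOn (fun y => mlKernel ν p η₁ y * mlKernel ν q η₂ (x - y)) (Set.Ioo 0 x) ∧
      HasSum (fun ij : ℕ × ℕ => PowerSeries.coeff ij.1 p * PowerSeries.coeff ij.2 q *
          riemannLiouvilleKernel (ν * (ij.1 + ij.2 : ℕ) + (η₁ + η₂)) x)
        (∫ y in Set.Ioo 0 x, mlKernel ν p η₁ y * mlKernel ν q η₂ (x - y)) := by
  set F : ℕ × ℕ → ℝ → ℝ := fun ij y => PowerSeries.coeff ij.1 p * PowerSeries.coeff ij.2 q *
    (riemannLiouvilleKernel (ν * ij.1 + η₁) y * riemannLiouvilleKernel (ν * ij.2 + η₂) (x - y))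
    with hF
  have hpos₁ (n : ℕ) : 0 < ν * n + η₁ := by positivity
  have hpos₂ (n : ℕ) : 0 < ν * n + η₂ := by positivity
  have hexponent (i j : ℕ) :
      ν * i + η₁ + (ν * j + η₂) = ν * (i + j : ℕ) + (η₁ + η₂) := by push_cast; ring
  have hFint (ij : ℕ × ℕ) : IntegrableOn (F ij) (Set.Ioo 0 x) := by
    refine Integrable.const_mul ?_ _
    exact (intervalIntegrable_iff_integrableOn_Ioo_of_le hx.le).1
      (intervalIntegrable_riemannLiouvilleKernel_mul (hpos₁ _) (hpos₂ _) hx)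
  have hFval (ij : ℕ × ℕ) : ∫ y in Set.Ioo 0 x, F ij y =
      PowerSeries.coeff ij.1 p * PowerSeries.coeff ij.2 q *
        riemannLiouvilleKernel (ν * (ij.1 + ij.2 : ℕ) + (η₁ + η₂)) x := by
    rw [integral_const_mul, ← intervalIntegral_eq_integral_Ioo hx.le,
      integral_riemannLiouvilleKernel_mul (hpos₁ _) (hpos₂ _) hx, hexponent]
  have hFsum : Summable fun ij => ∫ y in Set.Ioo 0 x, ‖F ij y‖ := by
    simpa only [hF, integral_norm_mul_riemannLiouvilleKernel_mul (hpos₁ _) (hpos₂ _) hx,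
      hexponent] using hp.summable_norm_coeff_mul_coeff_mul hq
        (superexponentialDecay_riemannLiouvilleKernel hν (add_pos h₁ h₂) hx)
  have hFf : ∀ᵐ y ∂volume.restrict (Set.Ioo 0 x),
      HasSum (fun ij => F ij y) (mlKernel ν p η₁ y * mlKernel ν q η₂ (x - y)) := by
    filter_upwards [ae_restrict_mem measurableSet_Ioo] with y hy
    exact hasSum_mlKernel_mul_mlKernel hp hq hν h₁ h₂ hy.1 (sub_pos.2 hy.2)
  have hmeas : Measurable fun y => mlKernel ν p η₁ y * mlKernel ν q η₂ (x - y) :=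
    (hp.measurable_mlKernel hν h₁).mul
      ((hq.measurable_mlKernel hν h₂).comp (measurable_const.sub measurable_id))
  simpa only [IntegrableOn, hFval] using integrable_and_hasSum_integral_of_summable_integral_norm
    hFint hFsum hmeas.aestronglyMeasurable hFf

theorem mlKernel_convolution (hp : GeomBounded p) (hq : GeomBounded q) (hν : 0 < ν)
    (h₁ : 0 < η₁) (h₂ : 0 < η₂) (hx : 0 < x) :
    IntervalIntegrable (fun y => mlKernel ν p η₁ y * mlKernel ν q η₂ (x - y)) volume 0 x ∧
      ∫ y in (0 : ℝ)..x, mlKernel ν p η₁ y * mlKernel ν q η₂ (x - y) =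
        mlKernel ν (p * q) (η₁ + η₂) x := by
  obtain ⟨hint, hsum⟩ :=
    integrableOn_and_hasSum_integral_mlKernel_mul_mlKernel hp hq hν h₁ h₂ hx
  refine ⟨(intervalIntegrable_iff_integrableOn_Ioo_of_le hx.le).2 hint, ?_⟩
  rw [intervalIntegral_eq_integral_Ioo hx.le, mlKernel_eq_tsum _ _ _ hx, ← hsum.tsum_eq]
  exact tsum_coeff_mul_coeff_mul (h := fun n => riemannLiouvilleKernel (ν * n + (η₁ + η₂)) x)
    hsum.summable

theorem integral_mlKernel (hp : GeomBounded p) (hν : 0 < ν) (h₁ : 0 < η₁) (hx : 0 < x) :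
    IntervalIntegrable (mlKernel ν p η₁) volume 0 x ∧
      ∫ y in (0 : ℝ)..x, mlKernel ν p η₁ y = mlKernel ν p (η₁ + 1) x := by
  simpa [mlKernel_one, riemannLiouvilleKernel_one] using
    mlKernel_convolution hp .one hν h₁ one_pos hx

theorem hasDerivAt_mlKernel_add_one (hp : GeomBounded p) (hν : 0 < ν) (h₁ : 0 < η₁)
    (hx : 0 < x) : HasDerivAt (mlKernel ν p (η₁ + 1)) (mlKernel ν p η₁ x) x := by
  have hderiv := intervalIntegral.integral_hasDerivAt_right (integral_mlKernel hp hν h₁ hx).1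
    (hp.measurable_mlKernel hν h₁).stronglyMeasurable.stronglyMeasurableAtFilter
    (hp.differentiableAt_mlKernel hν h₁ hx).continuousAt
  refine hderiv.congr_of_eventuallyEq ?_
  filter_upwards [lt_mem_nhds hx] with y hy using (integral_mlKernel hp hν h₁ hy).2.symm

theorem mlKernel_nonneg_of_convolution (hp : GeomBounded p) (hq : GeomBounded q) (hν : 0 < ν)
    (h₁ : 0 < η₁) (h₂ : 0 < η₂) (hpos₁ : ∀ y, 0 < y → 0 ≤ mlKernel ν p η₁ y)
    (hpos₂ : ∀ y, 0 < y → 0 ≤ mlKernel ν q η₂ y) (hx : 0 < x) :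
    0 ≤ mlKernel ν (p * q) (η₁ + η₂) x := by
  rw [← (mlKernel_convolution hp hq hν h₁ h₂ hx).2, intervalIntegral_eq_integral_Ioo hx.le]
  exact setIntegral_nonneg measurableSet_Ioo fun y hy =>
    mul_nonneg (hpos₁ y hy.1) (hpos₂ _ (sub_pos.2 hy.2))

end Convolution

/-- The power series `(1 + lam X) ^ (-d)`. -/
noncomputable def negBinomialSeries (lam : ℝ) (d : ℕ) : PowerSeries ℝ :=
  PowerSeries.rescale (-lam) (PowerSeries.mk 1) ^ d

theorem negBinomialSeries_zero (lam : ℝ) : negBinomialSeries lam 0 = 1 :=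
  pow_zero _

theorem negBinomialSeries_mul (lam : ℝ) (d e : ℕ) :
    negBinomialSeries lam d * negBinomialSeries lam e = negBinomialSeries lam (d + e) :=
  (pow_add _ _ _).symm

theorem coeff_negBinomialSeries_succ (lam : ℝ) (d j : ℕ) :
    PowerSeries.coeff j (negBinomialSeries lam (d + 1)) = (-lam) ^ j * ((d + j).choose d : ℝ) := by
  rw [negBinomialSeries, ← map_pow, PowerSeries.mk_one_pow_eq_mk_choose_add]
  simp [PowerSeries.coeff_rescale]

theorem coeff_negBinomialSeries_one (lam : ℝ) (j : ℕ) :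
    PowerSeries.coeff j (negBinomialSeries lam 1) = (-lam) ^ j := by
  simpa using coeff_negBinomialSeries_succ lam 0 j

theorem geomBounded_negBinomialSeries (lam : ℝ) (d : ℕ) :
    GeomBounded (negBinomialSeries lam d) := by
  cases d with
  | zero => exact negBinomialSeries_zero lam ▸ .one
  | succ d =>
    refine ⟨2 ^ d, 2 * (|lam| + 1), by positivity, by positivity, fun j => ?_⟩
    rw [coeff_negBinomialSeries_succ, abs_mul, abs_pow, abs_neg, Nat.abs_cast]
    have hchoose : ((d + j).choose d : ℝ) ≤ 2 ^ (d + j) := by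
      exact_mod_cast Nat.choose_le_two_pow _ _
    calc |lam| ^ j * ((d + j).choose d : ℝ) ≤ (|lam| + 1) ^ j * 2 ^ (d + j) := by
          gcongr
          linarith
      _ = 2 ^ d * (2 * (|lam| + 1)) ^ j := by rw [mul_pow, pow_add]; ring

theorem prabhakar_eq_mlSeries (lam ν η u : ℝ) (d : ℕ) :
    prabhakar (d + 1) ν η (-lam * u) = mlSeries ν (negBinomialSeries lam (d + 1)) η u := by
  rw [prabhakar, mlSeries]
  refine tsum_congr fun j => ?_
  have hcast : (d : ℝ) + 1 + j = ((d + j : ℕ) : ℝ) + 1 := by push_cast; ring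
  rw [coeff_negBinomialSeries_succ, hcast, Real.Gamma_nat_eq_factorial,
    Real.Gamma_nat_eq_factorial, Nat.cast_add_choose, mul_pow]
  have hd : (d.factorial : ℝ) ≠ 0 := by positivity
  have hj : (j.factorial : ℝ) ≠ 0 := by positivity
  field_simp

theorem rpow_mul_prabhakar (lam ν η x : ℝ) {d : ℕ} (hd : 1 ≤ d) :
    x ^ (η - 1) * prabhakar d ν η (-lam * x ^ ν) = mlKernel ν (negBinomialSeries lam d) η x := by
  obtain ⟨d, rfl⟩ := Nat.exists_eq_add_of_le' hd
  push_cast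
  rw [prabhakar_eq_mlSeries, mlKernel]

theorem mlKernel_negBinomialSeries_one_add {lam ν x : ℝ} (hν : 0 < ν) (hx : 0 < x) :
    mlKernel ν (negBinomialSeries lam 1) 1 x +
      lam * mlKernel ν (negBinomialSeries lam 1) (ν + 1) x = 1 := by
  have hb := geomBounded_negBinomialSeries lam 1
  rw [mlKernel_eq_tsum _ _ _ hx, mlKernel_eq_tsum _ _ _ hx, ← tsum_mul_left,
    (hb.hasSum_mlKernel hν one_pos hx).summable.tsum_eq_zero_add]
  have hcancel (j : ℕ) : PowerSeries.coeff (j + 1) (negBinomialSeries lam 1) *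
      riemannLiouvilleKernel (ν * (j + 1 : ℕ) + 1) x = -(lam *
      (PowerSeries.coeff j (negBinomialSeries lam 1) *
        riemannLiouvilleKernel (ν * j + (ν + 1)) x)) := by
    rw [coeff_negBinomialSeries_one, coeff_negBinomialSeries_one, pow_succ,
      show ν * ((j + 1 : ℕ) : ℝ) + 1 = ν * j + (ν + 1) by push_cast; ring]
    ring
  rw [tsum_congr hcancel, tsum_neg, neg_add_cancel_right, coeff_negBinomialSeries_one]
  simp [riemannLiouvilleKernel_one]

theorem riemannLiouvilleKernel_le_of_le {β x y : ℝ} (hβ : 0 ≤ β) (hβ1 : β ≤ 1) (hx : 0 < x)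
    (hxy : x ≤ y) : riemannLiouvilleKernel β y ≤ riemannLiouvilleKernel β x :=
  div_le_div_of_nonneg_right (Real.rpow_le_rpow_of_nonpos hx hxy (by linarith))
    (Real.Gamma_nonneg_of_nonneg hβ)

theorem integral_riemannLiouvilleKernel_sub {β a x : ℝ} (hβ : 0 < β) (hxa : x < a) :
    IntervalIntegrable (fun y => riemannLiouvilleKernel β (a - y)) volume x a ∧
      ∫ y in x..a, riemannLiouvilleKernel β (a - y) = riemannLiouvilleKernel (β + 1) (a - x) := by
  have hint := intervalIntegrable_riemannLiouvilleKernel_mul hβ one_pos (sub_pos.2 hxa)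
  have hval := integral_riemannLiouvilleKernel_mul hβ one_pos (sub_pos.2 hxa)
  simp only [riemannLiouvilleKernel_one, mul_one] at hint hval
  refine ⟨?_, by simpa using hval⟩
  simpa using (hint.comp_sub_left a).symm

section ExtremumPrinciple

variable {u : ℝ → ℝ} {β a : ℝ}

theorem integral_mul_riemannLiouvilleKernel_le {x M : ℝ} (hβ : 0 < β) (hβ1 : β ≤ 1) (hx : 0 < x)
    (hxa : x < a) (hu : ∀ y ∈ Set.Ioo 0 a, 0 ≤ u y) (huM : ∀ y ∈ Set.Ioo x a, u y ≤ M)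
    (hintx : IntervalIntegrable (fun y => u y * riemannLiouvilleKernel β (x - y)) volume 0 x)
    (hinta : IntervalIntegrable (fun y => u y * riemannLiouvilleKernel β (a - y)) volume 0 a) :
    ∫ y in (0 : ℝ)..a, u y * riemannLiouvilleKernel β (a - y) ≤
      (∫ y in (0 : ℝ)..x, u y * riemannLiouvilleKernel β (x - y)) +
        M * riemannLiouvilleKernel (β + 1) (a - x) := by
  obtain ⟨hkint, hkval⟩ := integral_riemannLiouvilleKernel_sub hβ hxa
  have hint₁ := hinta.mono_set (Set.uIcc_subset_uIcc_left (Set.mem_uIcc_of_le hx.le hxa.le))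
  have hint₂ := hinta.mono_set (Set.uIcc_subset_uIcc_right (Set.mem_uIcc_of_le hx.le hxa.le))
  rw [← intervalIntegral.integral_add_adjacent_intervals hint₁ hint₂, ← hkval,
    ← intervalIntegral.integral_const_mul]
  refine add_le_add ?_ ?_
  · refine intervalIntegral.integral_mono_on_of_le_Ioo hx.le hint₁ hintx fun y hy => ?_
    exact mul_le_mul_of_nonneg_left
      (riemannLiouvilleKernel_le_of_le hβ.le hβ1 (sub_pos.2 hy.2) (by linarith))
      (hu y ⟨hy.1, hy.2.trans hxa⟩)
  · refine intervalIntegral.integral_mono_on_of_le_Ioo hxa.le hint₂ (hkint.const_mul M)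
      fun y hy => ?_
    exact mul_le_mul_of_nonneg_right (huM y hy)
      (riemannLiouvilleKernel_nonneg hβ.le (sub_nonneg.2 hy.2.le))

theorem tendsto_riemannLiouvilleKernel_sub_nhdsLT (hβ : 0 < β) :
    Filter.Tendsto (fun x => riemannLiouvilleKernel (β + 1) (a - x)) (nhdsWithin a (Set.Iio a))
      (nhds 0) := by
  have hcont : Continuous fun x => riemannLiouvilleKernel (β + 1) (a - x) := by
    unfold riemannLiouvilleKernel
    exact ((Real.continuous_rpow_const (by linarith)).comp
      (continuous_const.sub continuous_id)).div_const _
  have hzero : riemannLiouvilleKernel (β + 1) (a - a) = 0 := by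
    simp [riemannLiouvilleKernel, Real.zero_rpow hβ.ne']
  exact (hzero ▸ hcont.tendsto a).mono_left nhdsWithin_le_nhds

theorem nonpos_of_hasDerivAt_integral_mul_riemannLiouvilleKernel {g : ℝ} (hβ : 0 < β)
    (hβ1 : β ≤ 1) (ha : 0 < a) (hu : ∀ y ∈ Set.Ioo 0 a, 0 ≤ u y) (hua : u a = 0)
    (hdiff : DifferentiableAt ℝ u a)
    (hint : ∀ x, 0 < x →
      IntervalIntegrable (fun y => u y * riemannLiouvilleKernel β (x - y)) volume 0 x)
    (hderiv : HasDerivAt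
      (fun x => ∫ y in (0 : ℝ)..x, u y * riemannLiouvilleKernel β (x - y)) g a) :
    g ≤ 0 := by
  -- Moving from `a` down to `x` raises the kernel on `(0, x)`, and the loss on `(x, a)` is
  -- `o(a - x)` because `u` is `O(a - y)` there.
  obtain ⟨C, hC⟩ := hdiff.isBigO_sub.bound
  obtain ⟨l, hla, hl⟩ := mem_nhdsLT_iff_exists_Ioo_subset.1 (nhdsWithin_le_nhds hC)
  have hslope := (hasDerivWithinAt_iff_tendsto_slope' Set.self_notMem_Iio).1
    (hderiv.hasDerivWithinAt (s := Set.Iio a))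
  refine le_of_tendsto_of_tendsto hslope
    (by simpa using (tendsto_riemannLiouvilleKernel_sub_nhdsLT hβ).const_mul |C|) ?_
  filter_upwards [Ioo_mem_nhdsLT (max_lt ha hla)] with x hx
  have hx0 : 0 < x := (le_max_left _ _).trans_lt hx.1
  have hbound : ∀ y ∈ Set.Ioo x a, u y ≤ |C| * (a - x) := fun y hy => by
    have huy : ‖u y - u a‖ ≤ C * ‖y - a‖ := hl ⟨(le_max_right _ _).trans_lt (hx.1.trans hy.1), hy.2⟩
    rw [hua, sub_zero, norm_sub_rev, Real.norm_of_nonneg (sub_nonneg.2 hy.2.le)] at huy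
    calc u y ≤ C * (a - y) := (le_abs_self _).trans huy
      _ ≤ |C| * (a - x) := by
        gcongr
        · exact sub_nonneg.2 hy.2.le
        · exact le_abs_self C
        · exact hy.1.le
  have hle := integral_mul_riemannLiouvilleKernel_le hβ hβ1 hx0 hx.2 hu hbound
    (hint x hx0) (hint a ha)
  rw [slope_comm, slope_def_field, div_le_iff₀ (sub_pos.2 hx.2)]
  linarith

end ExtremumPrinciple

theorem exists_neg_le_on_Ioo {f : ℝ → ℝ} {b : ℝ} (hf : ContinuousOn f (Set.Ioi 0))
    (hf0 : ∀ᶠ x in nhdsWithin 0 (Set.Ioi 0), 0 < f x) (hb : 0 < b) (hfb : f b < 0) :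
    ∃ a, 0 < a ∧ f a < 0 ∧ ∀ y ∈ Set.Ioo 0 a, f a ≤ f y := by
  obtain ⟨δ, hδ, hpos⟩ := mem_nhdsGT_iff_exists_Ioc_subset.1 hf0
  have hδ0 : 0 < δ := hδ
  have hδb : δ ≤ b := not_lt.1 fun hlt => (hpos ⟨hb, hlt.le⟩ : 0 < f b).not_gt hfb
  obtain ⟨a, ha, hmin⟩ := isCompact_Icc.exists_isMinOn (Set.nonempty_Icc.2 hδb)
    (hf.mono fun y hy => hδ0.trans_le hy.1)
  have hfa : f a < 0 := (hmin (Set.right_mem_Icc.2 hδb)).trans_lt hfb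
  refine ⟨a, hδ0.trans_le ha.1, hfa, fun y hy => ?_⟩
  rcases le_total y δ with hyδ | hyδ
  · exact (hfa.trans (hpos ⟨hy.1, hyδ⟩)).le
  · exact hmin ⟨hyδ, hy.2.le.trans ha.2⟩

theorem GeomBounded.eventually_mlKernel_pos {p : PowerSeries ℝ} {ν η : ℝ} (hp : GeomBounded p)
    (hν : 0 < ν) (hη : 0 < η) (hp0 : 0 < PowerSeries.coeff 0 p) :
    ∀ᶠ x in nhdsWithin 0 (Set.Ioi 0), 0 < mlKernel ν p η x := by
  have hcont : Continuous fun x : ℝ => mlSeries ν p η (x ^ ν) :=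
    (hp.differentiable_mlSeries hν hη).continuous.comp (Real.continuous_rpow_const hν.le)
  have hzero : 0 < mlSeries ν p η ((0 : ℝ) ^ ν) := by
    rw [Real.zero_rpow hν.ne', mlSeries_zero]
    exact mul_pos hp0 (inv_pos.2 (Real.Gamma_pos_of_pos hη))
  filter_upwards [self_mem_nhdsWithin,
    nhdsWithin_le_nhds (hcont.continuousAt.eventually (lt_mem_nhds hzero))] with x hx hpos
  exact mul_pos (Real.rpow_pos_of_pos hx _) hpos

section Positivity

variable {lam ν x : ℝ}

theorem hasDerivAt_mlKernel_negBinomialSeries_one (hν : 0 < ν) (hx : 0 < x) :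
    HasDerivAt (mlKernel ν (negBinomialSeries lam 1) 1)
      (-(lam * mlKernel ν (negBinomialSeries lam 1) ν x)) x := by
  have hderiv := ((hasDerivAt_mlKernel_add_one (geomBounded_negBinomialSeries lam 1) hν hν
    hx).const_mul lam).const_sub 1
  refine hderiv.congr_of_eventuallyEq ?_
  filter_upwards [lt_mem_nhds hx] with y hy
  linarith [mlKernel_negBinomialSeries_one_add (lam := lam) hν hy]

theorem mlKernel_index_one_negBinomialSeries_one (hx : 0 < x) :
    mlKernel 1 (negBinomialSeries lam 1) 1 x = Real.exp (-lam * x) := by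
  rw [mlKernel_eq_tsum _ _ _ hx, Real.exp_eq_exp_ℝ, NormedSpace.exp_eq_tsum_div]
  refine tsum_congr fun j => ?_
  rw [coeff_negBinomialSeries_one, riemannLiouvilleKernel, one_mul, Real.Gamma_nat_eq_factorial,
    add_sub_cancel_right, Real.rpow_natCast, mul_pow, mul_div_assoc]

theorem mlKernel_negBinomialSeries_one_nonneg_of_lt_one (hlam : 0 < lam) (hν : 0 < ν)
    (hν1 : ν < 1) (hx : 0 < x) : 0 ≤ mlKernel ν (negBinomialSeries lam 1) ν x := by
  -- If `f` is negative somewhere, let `a` be a point with `f a < 0` minimizing `f` over `(0, a]`.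
  -- The extremum principle for `f - f a` contradicts the relaxation equation `S' = -lam f`, where
  -- `S = E_{ν,1}(-lam x^ν)` is the fractional integral of `f` of order `1 - ν`.
  have hp := geomBounded_negBinomialSeries lam 1
  by_contra! hneg
  obtain ⟨a, ha, hfa, hmin⟩ := exists_neg_le_on_Ioo
    (fun y hy => (hp.differentiableAt_mlKernel hν hν hy).continuousAt.continuousWithinAt)
    (hp.eventually_mlKernel_pos hν hν (by simp [coeff_negBinomialSeries_one])) hx hneg
  set f := mlKernel ν (negBinomialSeries lam 1) ν
  have hβ : 0 < 1 - ν := sub_pos.2 hν1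
  have hconv {x : ℝ} (hx : 0 < x) := mlKernel_convolution hp .one hν hν hβ hx
  have hconst {x : ℝ} (hx : 0 < x) := mlKernel_convolution .one .one hν one_pos hβ hx
  simp only [mul_one, mlKernel_one, riemannLiouvilleKernel_one, one_mul,
    add_sub_cancel] at hconv hconst
  have hint (x : ℝ) (hx : 0 < x) : IntervalIntegrable
      (fun y => (f y - f a) * riemannLiouvilleKernel (1 - ν) (x - y)) volume 0 x := by
    simpa only [sub_mul] using (hconv hx).1.sub ((hconst hx).1.const_mul (f a))
  have hval (x : ℝ) (hx : 0 < x) :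
      ∫ y in (0 : ℝ)..x, (f y - f a) * riemannLiouvilleKernel (1 - ν) (x - y) =
        mlKernel ν (negBinomialSeries lam 1) 1 x -
          f a * mlKernel ν 1 (1 - ν + 1) x := by
    simp only [sub_mul]
    rw [intervalIntegral.integral_sub (hconv hx).1 ((hconst hx).1.const_mul (f a)),
      intervalIntegral.integral_const_mul, (hconv hx).2, (hconst hx).2, mlKernel_one,
      add_comm (1 : ℝ)]
  have hderiv := (hasDerivAt_mlKernel_negBinomialSeries_one (lam := lam) hν ha).sub
    ((hasDerivAt_mlKernel_add_one .one hν hβ ha).const_mul (f a))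
  have hle := nonpos_of_hasDerivAt_integral_mul_riemannLiouvilleKernel hβ (by linarith) ha
    (fun y hy => sub_nonneg.2 (hmin y hy)) (sub_self (f a))
    ((hp.differentiableAt_mlKernel hν hν ha).sub_const _) hint
    (hderiv.congr_of_eventuallyEq ((lt_mem_nhds ha).mono hval))
  rw [mlKernel_one] at hle
  nlinarith [mul_neg_of_pos_of_neg hlam hfa,
    mul_neg_of_neg_of_pos hfa (riemannLiouvilleKernel_pos hβ ha)]

theorem mlKernel_negBinomialSeries_nonneg (hlam : 0 < lam) (hν : 0 < ν) (hν1 : ν ≤ 1) {d : ℕ}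
    {η : ℝ} (hη0 : 0 < η) (hη : ν * d ≤ η) (hx : 0 < x) :
    0 ≤ mlKernel ν (negBinomialSeries lam d) η x := by
  have hdensity (y : ℝ) (hy : 0 < y) : 0 ≤ mlKernel ν (negBinomialSeries lam 1) ν y := by
    rcases hν1.lt_or_eq with hlt | rfl
    · exact mlKernel_negBinomialSeries_one_nonneg_of_lt_one hlam hν hlt hy
    · exact mlKernel_index_one_negBinomialSeries_one hy ▸ (Real.exp_pos _).le
  induction d generalizing η x with
  | zero =>
    rw [negBinomialSeries_zero, mlKernel_one]
    exact riemannLiouvilleKernel_nonneg hη0.le hx.le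
  | succ d ih =>
    push_cast at hη
    rcases eq_or_ne η ν with rfl | hne
    · obtain rfl : d = 0 := by
        have : (d : ℝ) ≤ 0 := by nlinarith
        exact_mod_cast this.antisymm d.cast_nonneg
      exact hdensity x hx
    · have hνη : ν < η := lt_of_le_of_ne (by nlinarith [d.cast_nonneg (α := ℝ)]) hne.symm
      have hnonneg := mlKernel_nonneg_of_convolution (geomBounded_negBinomialSeries lam d)
        (geomBounded_negBinomialSeries lam 1) hν (sub_pos.2 hνη) hν
        (fun y hy => ih (sub_pos.2 hνη) (by linarith) hy) hdensity hx
      rwa [negBinomialSeries_mul, sub_add_cancel] at hnonneg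

end Positivity

section MeasureLemmas

theorem withDensity_restrict_Ioi_conv_withDensity_restrict_Ioi {f g : ℝ → ENNReal}
    (hf : Measurable f) (hg : Measurable g) :
    (volume.restrict (Set.Ioi 0)).withDensity f ∗ (volume.restrict (Set.Ioi 0)).withDensity g =
      (volume.restrict (Set.Ioi 0)).withDensity
        fun x => ∫⁻ y in Set.Ioo 0 x, f y * g (x - y) := by
  have hsupp (x y : ℝ) : (Set.Ioi 0).indicator f y * (Set.Ioi 0).indicator g (-y + x) =
      (Set.Ioo 0 x).indicator (fun y => f y * g (x - y)) y := by
    by_cases h₁ : 0 < y <;> by_cases h₂ : y < x <;> simp [h₁, h₂, neg_add_eq_sub]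
  simp only [← withDensity_indicator measurableSet_Ioi]
  rw [conv_withDensity_eq_lconvolution (hf.indicator measurableSet_Ioi)
    (hg.indicator measurableSet_Ioi)]
  congr 1 with x
  simp only [lconvolution_def, hsupp, lintegral_indicator measurableSet_Ioo]
  rcases le_or_gt x 0 with hx | hx
  · simp [hx]
  · simp [hx]

theorem indepFun_measure_eq_lintegral {Ω α β : Type*} [MeasurableSpace Ω] [MeasurableSpace α]
    [MeasurableSpace β] {P : Measure Ω} [IsProbabilityMeasure P] {X : Ω → α} {Y : Ω → β}
    {μ : Measure α} (hind : IndepFun X Y P) (hX : HasLaw X μ P) (hY : Measurable Y)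
    {A : Set (α × β)} (hA : MeasurableSet A) :
    P {ω | (X ω, Y ω) ∈ A} = ∫⁻ x, P {ω | (x, Y ω) ∈ A} ∂μ := by
  have : IsProbabilityMeasure μ := hX.isProbabilityMeasure_iff.1 inferInstance
  have : IsProbabilityMeasure (P.map Y) := Measure.isProbabilityMeasure_map hY.aemeasurable
  rw [(hind.hasLaw_prod hX ⟨hY.aemeasurable, rfl⟩).measure_eq (p := (· ∈ A)) hA,
    Set.ofPred_mem_eq, Measure.prod_apply hA]
  exact lintegral_congr fun x => Measure.map_apply hY (measurable_prodMk_left hA)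

theorem iIndepFun_indepFun_range_shift {Ω E : Type*} [MeasurableSpace Ω] [MeasurableSpace E]
    {P : Measure Ω} {X : ℕ → Ω → E} (hind : iIndepFun X P) (hX : ∀ n, Measurable (X n)) (k : ℕ) :
    IndepFun (fun ω (i : Finset.range k) => X i ω) (fun ω i => X (k + i) ω) P := by
  have := hind.isProbabilityMeasure
  refine IndepFun.indepFun_process (by fun_prop) (fun i => hX (k + i)) fun I => ?_
  have hdisj : Disjoint (Finset.range k) (I.map (addLeftEmbedding k)) := by
    simp only [Finset.disjoint_left, Finset.mem_range, Finset.mem_map, addLeftEmbedding_apply]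
    lia
  have hmem (i : I) : k + i ∈ I.map (addLeftEmbedding k) := by simp
  exact (hind.indepFun_finset _ _ hdisj hX).comp measurable_id
    (ψ := fun v (i : I) => v ⟨k + i, hmem i⟩) (by fun_prop)

end MeasureLemmas

/-- The density `lam ^ n * x ^ (ν n - 1) * E^n_{ν, ν n}(-lam * x ^ ν)` of the `n`-th event time,
for `1 ≤ n`. -/
noncomputable def eventTimeDensity (lam ν : ℝ) (n : ℕ) (x : ℝ) : ℝ :=
  lam ^ n * (x ^ (ν * n - 1) * prabhakar n ν (ν * n) (-lam * x ^ ν))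

/-- The probability `lam ^ m * u ^ (ν m) * E^{m + 1}_{ν, ν m + 1}(-lam * u ^ ν)` that exactly `m`
events occur up to time `u`. -/
noncomputable def countProbability (lam ν : ℝ) (m : ℕ) (u : ℝ) : ℝ :=
  lam ^ m * (u ^ (ν * m) * prabhakar (m + 1) ν (ν * m + 1) (-lam * u ^ ν))

/-- The law on `(0, ∞)` with density `eventTimeDensity lam ν n`. -/
noncomputable def eventTimeLaw (lam ν : ℝ) (n : ℕ) : Measure ℝ :=
  (volume.restrict (Set.Ioi 0)).withDensity fun x => ENNReal.ofReal (eventTimeDensity lam ν n x)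

theorem lintegral_ofReal_Ioo_eq_ofReal_intervalIntegral {f : ℝ → ℝ} {a b : ℝ} (hab : a ≤ b)
    (hf : IntervalIntegrable f volume a b) (hf0 : ∀ y ∈ Set.Ioo a b, 0 ≤ f y) :
    ∫⁻ y in Set.Ioo a b, ENNReal.ofReal (f y) = ENNReal.ofReal (∫ y in a..b, f y) := by
  rw [intervalIntegral_eq_integral_Ioo hab, ofReal_integral_eq_lintegral_ofReal
    ((intervalIntegrable_iff_integrableOn_Ioo_of_le hab).1 hf)]
  filter_upwards [ae_restrict_mem measurableSet_Ioo] with y hy using hf0 y hy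

section Densities

variable {lam ν : ℝ}

theorem mittagLefflerLaw_eq_eventTimeLaw (lam ν : ℝ) :
    mittagLefflerLaw lam ν = eventTimeLaw lam ν 1 := by
  simp only [mittagLefflerLaw, eventTimeLaw, eventTimeDensity, mittagLeffler, mul_assoc, pow_one,
    Nat.cast_one, mul_one]

theorem mittagLefflerLaw_ae_pos (lam ν : ℝ) : ∀ᵐ x ∂mittagLefflerLaw lam ν, 0 < x :=
  (withDensity_absolutelyContinuous _ _).ae_le (ae_restrict_mem measurableSet_Ioi)

theorem eventTimeDensity_eq_mlKernel (lam ν : ℝ) {n : ℕ} (hn : 1 ≤ n) :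
    eventTimeDensity lam ν n =
      fun x => lam ^ n * mlKernel ν (negBinomialSeries lam n) (ν * n) x :=
  funext fun x => by rw [eventTimeDensity, rpow_mul_prabhakar lam ν _ x hn]

theorem countProbability_eq_mlKernel (lam ν : ℝ) (m : ℕ) :
    countProbability lam ν m =
      fun u => lam ^ m * mlKernel ν (negBinomialSeries lam (m + 1)) (ν * m + 1) u :=
  funext fun u => by
    rw [countProbability, ← rpow_mul_prabhakar lam ν _ u (Nat.le_add_left 1 m),
      add_sub_cancel_right, Nat.cast_add_one]

theorem measurable_eventTimeDensity (hν : 0 < ν) {n : ℕ} (hn : 1 ≤ n) :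
    Measurable (eventTimeDensity lam ν n) :=
  have hn' : 0 < ν * n := mul_pos hν (by exact_mod_cast hn)
  eventTimeDensity_eq_mlKernel lam ν hn ▸
    ((geomBounded_negBinomialSeries lam n).measurable_mlKernel hν hn').const_mul _

theorem measurable_countProbability (hν : 0 < ν) (m : ℕ) :
    Measurable (countProbability lam ν m) :=
  countProbability_eq_mlKernel lam ν m ▸
    ((geomBounded_negBinomialSeries lam _).measurable_mlKernel hν (by positivity)).const_mul _

theorem eventTimeDensity_nonneg (hlam : 0 < lam) (hν : 0 < ν) (hν1 : ν ≤ 1) {n : ℕ} (hn : 1 ≤ n)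
    {x : ℝ} (hx : 0 < x) : 0 ≤ eventTimeDensity lam ν n x := by
  have hn' : 0 < ν * n := mul_pos hν (by exact_mod_cast hn)
  have := mlKernel_negBinomialSeries_nonneg hlam hν hν1 hn' le_rfl hx
  rw [eventTimeDensity_eq_mlKernel lam ν hn]
  positivity

theorem countProbability_nonneg (hlam : 0 < lam) (hν : 0 < ν) (hν1 : ν ≤ 1) (m : ℕ) {u : ℝ}
    (hu : 0 < u) : 0 ≤ countProbability lam ν m u := by
  have := mlKernel_negBinomialSeries_nonneg hlam hν hν1 (d := m + 1) (η := ν * m + 1)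
    (by positivity) (by push_cast; linarith) hu
  rw [countProbability_eq_mlKernel]
  positivity

theorem eventTimeDensity_convolution (hν : 0 < ν) {m n : ℕ} (hm : 1 ≤ m) (hn : 1 ≤ n)
    {x : ℝ} (hx : 0 < x) :
    IntervalIntegrable (fun y => eventTimeDensity lam ν m y * eventTimeDensity lam ν n (x - y))
        volume 0 x ∧
      ∫ y in (0 : ℝ)..x, eventTimeDensity lam ν m y * eventTimeDensity lam ν n (x - y) =
        eventTimeDensity lam ν (m + n) x := by
  have hm' : 0 < ν * m := mul_pos hν (by exact_mod_cast hm)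
  have hn' : 0 < ν * n := mul_pos hν (by exact_mod_cast hn)
  obtain ⟨hint, hval⟩ := mlKernel_convolution (geomBounded_negBinomialSeries lam m)
    (geomBounded_negBinomialSeries lam n) hν hm' hn' hx
  simp only [eventTimeDensity_eq_mlKernel lam ν hm, eventTimeDensity_eq_mlKernel lam ν hn,
    eventTimeDensity_eq_mlKernel lam ν (Nat.le_add_right_of_le hm), mul_mul_mul_comm (lam ^ m)]
  refine ⟨hint.const_mul _, ?_⟩
  rw [intervalIntegral.integral_const_mul, hval, negBinomialSeries_mul, Nat.cast_add, mul_add,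
    pow_add]

theorem eventTimeDensity_countProbability_convolution (hν : 0 < ν) {n : ℕ} (hn : 1 ≤ n)
    (m : ℕ) {u : ℝ} (hu : 0 < u) :
    IntervalIntegrable (fun y => eventTimeDensity lam ν n y * countProbability lam ν m (u - y))
        volume 0 u ∧
      ∫ y in (0 : ℝ)..u, eventTimeDensity lam ν n y * countProbability lam ν m (u - y) =
        countProbability lam ν (n + m) u := by
  have hn' : 0 < ν * n := mul_pos hν (by exact_mod_cast hn)
  have hm' : 0 < ν * m + 1 := by positivity
  obtain ⟨hint, hval⟩ := mlKernel_convolution (geomBounded_negBinomialSeries lam n)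
    (geomBounded_negBinomialSeries lam (m + 1)) hν hn' hm' hu
  simp only [eventTimeDensity_eq_mlKernel lam ν hn, countProbability_eq_mlKernel,
    mul_mul_mul_comm (lam ^ n)]
  refine ⟨hint.const_mul _, ?_⟩
  rw [intervalIntegral.integral_const_mul, hval, negBinomialSeries_mul, Nat.cast_add, mul_add,
    pow_add, add_assoc, add_assoc]

theorem intervalIntegrable_eventTimeDensity_mul_countProbability (hν : 0 < ν) {n : ℕ}
    (hn : 1 ≤ n) (m : ℕ) {a u : ℝ} (ha : 0 ≤ a) (hau : a ≤ u) :
    IntervalIntegrable (fun y => eventTimeDensity lam ν n y * countProbability lam ν m (u - y))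
      volume a u := by
  rcases (ha.trans hau).eq_or_lt with rfl | hu
  · rw [le_antisymm hau ha]
  · refine (eventTimeDensity_countProbability_convolution hν hn m hu).1.mono_set ?_
    rw [Set.uIcc_of_le hau, Set.uIcc_of_le hu.le]
    exact Set.Icc_subset_Icc_left ha

theorem eventTimeLaw_conv_eventTimeLaw (hlam : 0 < lam) (hν : 0 < ν) (hν1 : ν ≤ 1) {m n : ℕ}
    (hm : 1 ≤ m) (hn : 1 ≤ n) :
    eventTimeLaw lam ν m ∗ eventTimeLaw lam ν n = eventTimeLaw lam ν (m + n) := by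
  have hm0 {x : ℝ} (hx : 0 < x) := eventTimeDensity_nonneg hlam hν hν1 hm hx
  have hn0 {x : ℝ} (hx : 0 < x) := eventTimeDensity_nonneg hlam hν hν1 hn hx
  rw [eventTimeLaw, eventTimeLaw, withDensity_restrict_Ioi_conv_withDensity_restrict_Ioi
    (measurable_eventTimeDensity hν hm).ennreal_ofReal
    (measurable_eventTimeDensity hν hn).ennreal_ofReal]
  refine withDensity_congr_ae ((ae_restrict_mem measurableSet_Ioi).mono fun x hx => ?_)
  beta_reduce
  obtain ⟨hint, hval⟩ := eventTimeDensity_convolution hν hm hn hx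
  rw [← hval, ← lintegral_ofReal_Ioo_eq_ofReal_intervalIntegral (le_of_lt hx) hint
    fun y hy => mul_nonneg (hm0 hy.1) (hn0 (sub_pos.2 hy.2))]
  exact setLIntegral_congr_fun measurableSet_Ioo fun y hy => (ENNReal.ofReal_mul (hm0 hy.1)).symm

theorem mittagLefflerLaw_Ioi [IsProbabilityMeasure (mittagLefflerLaw lam ν)] (hlam : 0 < lam)
    (hν : 0 < ν) (hν1 : ν ≤ 1) {u : ℝ} (hu : 0 < u) :
    mittagLefflerLaw lam ν (Set.Ioi u) = ENNReal.ofReal (countProbability lam ν 0 u) := by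
  have hdensity : eventTimeDensity lam ν 1 =
      fun x => lam * mlKernel ν (negBinomialSeries lam 1) ν x := by
    simpa using eventTimeDensity_eq_mlKernel lam ν le_rfl
  have hnonneg {x : ℝ} (hx : 0 < x) := eventTimeDensity_nonneg hlam hν hν1 le_rfl hx
  obtain ⟨hint, hval⟩ := integral_mlKernel (geomBounded_negBinomialSeries lam 1) hν hν hu
  have hint' : IntervalIntegrable (eventTimeDensity lam ν 1) volume 0 u :=
    hdensity ▸ hint.const_mul lam
  have hIic : mittagLefflerLaw lam ν (Set.Iic u) =
      ENNReal.ofReal (∫ x in (0 : ℝ)..u, eventTimeDensity lam ν 1 x) := by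
    rw [← lintegral_ofReal_Ioo_eq_ofReal_intervalIntegral hu.le hint' fun y hy => hnonneg hy.1,
      mittagLefflerLaw_eq_eventTimeLaw, eventTimeLaw, withDensity_apply _ measurableSet_Iic,
      Measure.restrict_restrict measurableSet_Iic, Set.Iic_inter_Ioi, restrict_Ioo_eq_restrict_Ioc]
  have hsurvival :
      countProbability lam ν 0 u = 1 - ∫ x in (0 : ℝ)..u, eventTimeDensity lam ν 1 x := by
    rw [hdensity, intervalIntegral.integral_const_mul, hval, countProbability_eq_mlKernel]
    simpa using eq_sub_of_add_eq (mlKernel_negBinomialSeries_one_add hν hu)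
  rw [← Set.compl_Iic, prob_compl_eq_one_sub measurableSet_Iic, hIic, hsurvival,
    ENNReal.ofReal_sub _ (intervalIntegral_eq_integral_Ioo hu.le ▸
      setIntegral_nonneg measurableSet_Ioo fun x hx => hnonneg hx.1), ENNReal.ofReal_one]

end Densities

/-- The interarrival sequences of the renewal processes with exactly `m` events up to time `u`: the
`m`-th event occurs by time `u` and the next one occurs later. No event has occurred before time
`0`, so `renewalCountSet u 0` is empty for `u < 0`. -/
def renewalCountSet (u : ℝ) (m : ℕ) : Set (ℕ → ℝ) :=
  {x | ∑ i ∈ Finset.range m, x i ≤ u ∧ u < ∑ i ∈ Finset.range (m + 1), x i}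

section RenewalCountSet

theorem mem_renewalCountSet_zero {x : ℕ → ℝ} {u : ℝ} :
    x ∈ renewalCountSet u 0 ↔ 0 ≤ u ∧ u < x 0 := by
  simp [renewalCountSet]

theorem mem_renewalCountSet_add {x : ℕ → ℝ} {u : ℝ} {k m : ℕ} :
    x ∈ renewalCountSet u (k + m) ↔
      (fun i => x (k + i)) ∈ renewalCountSet (u - ∑ i ∈ Finset.range k, x i) m := by
  simp only [renewalCountSet, Set.mem_ofPred_eq, add_assoc, Finset.sum_range_add _ k,
    le_sub_iff_add_le', sub_lt_iff_lt_add']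

theorem measurableSet_mem_renewalCountSet {α : Type*} [MeasurableSpace α] {u : α → ℝ}
    {x : α → ℕ → ℝ} (hu : Measurable u) (hx : Measurable x) (m : ℕ) :
    MeasurableSet {a | x a ∈ renewalCountSet (u a) m} :=
  (measurableSet_le (by fun_prop) hu).inter (measurableSet_lt hu (by fun_prop))

theorem le_of_mem_renewalCountSet {x : ℕ → ℝ} (hx : ∀ n, 0 < x n) {u : ℝ} {m : ℕ}
    (h : x ∈ renewalCountSet u m) : 0 ≤ u :=
  (Finset.sum_nonneg fun i _ => (hx i).le).trans h.1

theorem setOf_sum_range_le_eq_Icc {x : ℕ → ℝ} (hx : ∀ n, 0 < x n) {u : ℝ} {m : ℕ}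
    (h : x ∈ renewalCountSet u m) :
    {n : ℕ | 1 ≤ n ∧ ∑ i ∈ Finset.range n, x i ≤ u} = Set.Icc 1 m := by
  have hmono : StrictMono fun n => ∑ i ∈ Finset.range n, x i := strictMono_nat_of_lt_succ fun n =>
    Finset.sum_range_succ x n ▸ lt_add_of_pos_right _ (hx n)
  ext n
  refine and_congr_right fun _ => ⟨fun hn => ?_, fun hn => (hmono.monotone hn).trans h.1⟩
  exact Nat.lt_succ_iff.1 (hmono.lt_iff_lt.1 (hn.trans_lt h.2))

theorem exists_mem_renewalCountSet {x : ℕ → ℝ} {u : ℝ} (hu : 0 ≤ u) {k : ℕ}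
    (h : {n : ℕ | 1 ≤ n ∧ ∑ i ∈ Finset.range n, x i ≤ u}.encard = k) :
    ∃ m, x ∈ renewalCountSet u m := by
  by_contra! hnot
  have hle (n : ℕ) : ∑ i ∈ Finset.range n, x i ≤ u := by
    induction n with
    | zero => simpa using hu
    | succ n ih => exact not_lt.1 fun hlt => hnot n ⟨ih, hlt⟩
  have hIci : {n : ℕ | 1 ≤ n ∧ ∑ i ∈ Finset.range n, x i ≤ u} = Set.Ici 1 := by
    simp only [hle, and_true, Set.Ici_def]
  rw [hIci, (Set.Ici_infinite 1).encard_eq] at h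
  exact ENat.top_ne_natCast k h

theorem encard_setOf_sum_range_le_eq_iff {x : ℕ → ℝ} (hx : ∀ n, 0 < x n) {u : ℝ} (hu : 0 ≤ u)
    {k : ℕ} :
    {n : ℕ | 1 ≤ n ∧ ∑ i ∈ Finset.range n, x i ≤ u}.encard = k ↔ x ∈ renewalCountSet u k := by
  have hcard {m : ℕ} (h : x ∈ renewalCountSet u m) :
      {n : ℕ | 1 ≤ n ∧ ∑ i ∈ Finset.range n, x i ≤ u}.encard = m := by
    rw [setOf_sum_range_le_eq_Icc hx h, ← Finset.coe_Icc, Set.encard_coe_eq_coe_finsetCard,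
      Nat.card_Icc, Nat.add_sub_cancel]
  refine ⟨fun h => ?_, hcard⟩
  obtain ⟨m, hm⟩ := exists_mem_renewalCountSet hu h
  rwa [show k = m by exact_mod_cast h.symm.trans (hcard hm)]

end RenewalCountSet

/-- `J` is a measurable version of the sequence of interarrival times of a fractional Poisson
process with rate `lam` and index `ν`. -/
structure IsInterarrivalSequence {Ω : Type*} [MeasurableSpace Ω] (lam ν : ℝ) (J : ℕ → Ω → ℝ)
    (P : Measure Ω) : Prop where
  indep : iIndepFun J P
  measurable : ∀ n, Measurable (J n)
  hasLaw : ∀ n, HasLaw (J n) (mittagLefflerLaw lam ν) P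

theorem IsFractionalPoissonProcess.exists_isInterarrivalSequence {Ω : Type*} [MeasurableSpace Ω]
    {lam ν : ℝ} {N : ℝ → Ω → ℕ} {P : Measure Ω} (hN : IsFractionalPoissonProcess lam ν N P) :
    ∃ J : ℕ → Ω → ℝ, IsInterarrivalSequence lam ν J P ∧ ∀ᵐ ω ∂P, ∀ t : ℝ, 0 ≤ t →
      (N t ω : ℕ∞) = Set.encard {n : ℕ | 1 ≤ n ∧ eventTime J n ω ≤ t} := by
  obtain ⟨J, hind, hlaw, hcount⟩ := hN
  have hmk (n : ℕ) : J n =ᵐ[P] (hlaw n).aemeasurable.mk (J n) := (hlaw n).aemeasurable.ae_eq_mk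
  refine ⟨fun n => (hlaw n).aemeasurable.mk (J n), ⟨hind.congr hmk,
    fun n => (hlaw n).aemeasurable.measurable_mk, fun n => (hlaw n).congr (hmk n).symm⟩, ?_⟩
  filter_upwards [hcount, ae_all_iff.2 hmk] with ω hω hJ t ht
  simp only [hω t ht, eventTime, hJ]

namespace IsInterarrivalSequence

variable {Ω : Type*} [MeasurableSpace Ω] {P : Measure Ω} {lam ν : ℝ} {J : ℕ → Ω → ℝ}

theorem isProbabilityMeasure (hJ : IsInterarrivalSequence lam ν J P) : IsProbabilityMeasure P :=
  hJ.indep.isProbabilityMeasure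

theorem isProbabilityMeasure_mittagLefflerLaw (hJ : IsInterarrivalSequence lam ν J P) :
    IsProbabilityMeasure (mittagLefflerLaw lam ν) :=
  (hJ.hasLaw 0).isProbabilityMeasure_iff.1 hJ.isProbabilityMeasure

theorem shift (hJ : IsInterarrivalSequence lam ν J P) (k : ℕ) :
    IsInterarrivalSequence lam ν (fun i => J (k + i)) P where
  indep := hJ.indep.precomp (add_right_injective k)
  measurable _ := hJ.measurable _
  hasLaw _ := hJ.hasLaw _

theorem ae_pos (hJ : IsInterarrivalSequence lam ν J P) : ∀ᵐ ω ∂P, ∀ n, 0 < J n ω :=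
  ae_all_iff.2 fun n => ae_of_ae_map (hJ.hasLaw n).aemeasurable
    ((hJ.hasLaw n).map_eq ▸ mittagLefflerLaw_ae_pos lam ν)

theorem hasLaw_eventTime (hJ : IsInterarrivalSequence lam ν J P) (hlam : 0 < lam) (hν : 0 < ν)
    (hν1 : ν ≤ 1) {n : ℕ} (hn : 1 ≤ n) :
    HasLaw (eventTime J n) (eventTimeLaw lam ν n) P := by
  have := hJ.isProbabilityMeasure
  induction n, hn using Nat.le_induction with
  | base =>
    have hone : eventTime J 1 = J 0 := funext fun ω => Finset.sum_range_one _
    exact hone ▸ mittagLefflerLaw_eq_eventTimeLaw lam ν ▸ hJ.hasLaw 0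
  | succ n hn ih =>
    have := hJ.isProbabilityMeasure_mittagLefflerLaw
    have : IsProbabilityMeasure (eventTimeLaw lam ν n) :=
      ih.isProbabilityMeasure_iff.1 inferInstance
    have hindep : IndepFun (eventTime J n) (J n) P := by
      convert hJ.indep.indepFun_sum_range_succ hJ.measurable n using 1
      exact funext fun ω => (Finset.sum_apply ω _ _).symm
    have hsucc : eventTime J (n + 1) = eventTime J n + J n :=
      funext fun ω => Finset.sum_range_succ _ _
    rw [hsucc, ← eventTimeLaw_conv_eventTimeLaw hlam hν hν1 hn le_rfl,
      ← mittagLefflerLaw_eq_eventTimeLaw]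
    exact hindep.hasLaw_add ih (hJ.hasLaw n)

theorem indepFun_eventTime_shift (hJ : IsInterarrivalSequence lam ν J P) (k : ℕ) :
    IndepFun (eventTime J k) (fun ω i => J (k + i) ω) P := by
  have hsum : eventTime J k =
      (fun v => ∑ i, v i) ∘ fun ω (i : Finset.range k) => J i ω :=
    funext fun ω => (Finset.sum_coe_sort (Finset.range k) fun i => J i ω).symm
  rw [hsum]
  exact (iIndepFun_indepFun_range_shift hJ.indep hJ.measurable k).comp (by fun_prop) measurable_id

theorem measure_eventTime_shift_mem (hJ : IsInterarrivalSequence lam ν J P) (hlam : 0 < lam)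
    (hν : 0 < ν) (hν1 : ν ≤ 1) {k : ℕ} (hk : 1 ≤ k) {A : Set (ℝ × (ℕ → ℝ))} (hA : MeasurableSet A)
    {a b : ℝ} {q : ℝ → ℝ} (ha : 0 ≤ a)
    (hout : ∀ w, 0 < w → w ∉ Set.Icc a b → P {ω | (w, fun i => J (k + i) ω) ∈ A} = 0)
    (hin : ∀ w ∈ Set.Ioo a b, P {ω | (w, fun i => J (k + i) ω) ∈ A} = ENNReal.ofReal (q w)) :
    P {ω | (eventTime J k ω, fun i => J (k + i) ω) ∈ A} =
      ∫⁻ w in Set.Ioo a b, ENNReal.ofReal (eventTimeDensity lam ν k w * q w) := by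
  have := hJ.isProbabilityMeasure
  rw [indepFun_measure_eq_lintegral (hJ.indepFun_eventTime_shift k)
      (hJ.hasLaw_eventTime hlam hν hν1 hk) (measurable_pi_lambda _ fun i => hJ.measurable _) hA,
    eventTimeLaw, lintegral_withDensity_eq_lintegral_mul_non_measurable _
      (measurable_eventTimeDensity hν hk).ennreal_ofReal (by simp),
    ← lintegral_indicator measurableSet_Ioi, ← lintegral_indicator measurableSet_Ioo]
  refine lintegral_congr_ae ?_
  filter_upwards [Measure.ae_ne volume a, Measure.ae_ne volume b] with w hwa hwb
  by_cases hw : w ∈ Set.Ioo a b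
  · have hw0 : 0 < w := ha.trans_lt hw.1
    rw [Set.indicator_of_mem hw, Set.indicator_of_mem (Set.mem_Ioi.2 hw0), Pi.mul_apply, hin w hw,
      ← ENNReal.ofReal_mul (eventTimeDensity_nonneg hlam hν hν1 hk hw0)]
  · have hw' : w ∉ Set.Icc a b := fun h => hw ⟨h.1.lt_of_ne hwa.symm, h.2.lt_of_ne hwb⟩
    rw [Set.indicator_of_notMem hw, Set.indicator_apply_eq_zero]
    exact fun hw0 => by rw [Pi.mul_apply, hout w hw0 hw', mul_zero]

end IsInterarrivalSequence

/-- The probability, for `0 ≤ s ≤ t`, that no event occurs up to time `s` and exactly `m + 1` events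
occur up to time `t`. The integration variable `y` is the time of the first event. -/
noncomputable def delayedCountProbability (lam ν : ℝ) (m : ℕ) (s t : ℝ) : ℝ :=
  ∫ y in s..t, eventTimeDensity lam ν 1 y * countProbability lam ν m (t - y)

section DelayedCountProbability

variable {lam ν : ℝ}

theorem measurable_intervalIntegral_mul_comp_sub {f g : ℝ → ℝ} (hf : Measurable f)
    (hg : Measurable g) {s t : ℝ} (hst : s ≤ t) :
    Measurable fun w => ∫ y in (s - w)..(t - w), f y * g (t - w - y) := by
  let A : Set (ℝ × ℝ) := {p | s - p.1 < p.2 ∧ p.2 ≤ t - p.1}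
  have hA : MeasurableSet A :=
    (measurableSet_lt (by fun_prop) measurable_snd).inter
      (measurableSet_le measurable_snd (by fun_prop))
  have hslice (w : ℝ) : ∫ y in (s - w)..(t - w), f y * g (t - w - y) =
      ∫ y, A.indicator (fun p => f p.2 * g (t - p.1 - p.2)) (w, y) := by
    rw [intervalIntegral.integral_of_le (sub_le_sub_right hst w),
      ← integral_indicator measurableSet_Ioc]
    rfl
  have hind : Measurable (A.indicator fun p => f p.2 * g (t - p.1 - p.2)) :=
    Measurable.indicator (by fun_prop) hA
  simp only [hslice]
  exact hind.stronglyMeasurable.integral_prod_right'.measurable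

theorem measurable_delayedCountProbability (hν : 0 < ν) (m : ℕ) {s t : ℝ} (hst : s ≤ t) :
    Measurable fun w => delayedCountProbability lam ν m (s - w) (t - w) :=
  measurable_intervalIntegral_mul_comp_sub (measurable_eventTimeDensity hν le_rfl)
    (measurable_countProbability hν m) hst

theorem delayedCountProbability_nonneg (hlam : 0 < lam) (hν : 0 < ν) (hν1 : ν ≤ 1) (m : ℕ)
    {s t : ℝ} (hs : 0 ≤ s) (hst : s ≤ t) : 0 ≤ delayedCountProbability lam ν m s t := by
  rw [delayedCountProbability, intervalIntegral_eq_integral_Ioo hst]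
  exact setIntegral_nonneg measurableSet_Ioo fun y hy => mul_nonneg
    (eventTimeDensity_nonneg hlam hν hν1 le_rfl (hs.trans_lt hy.1))
    (countProbability_nonneg hlam hν hν1 m (sub_pos.2 hy.2))

end DelayedCountProbability

namespace IsInterarrivalSequence

variable {Ω : Type*} [MeasurableSpace Ω] {P : Measure Ω} {lam ν : ℝ} {J : ℕ → Ω → ℝ}

theorem measure_mem_renewalCountSet_of_neg (hJ : IsInterarrivalSequence lam ν J P) {u : ℝ}
    (hu : u < 0) (m : ℕ) : P {ω | (fun i => J i ω) ∈ renewalCountSet u m} = 0 :=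
  measure_eq_zero_iff_ae_notMem.2 <| hJ.ae_pos.mono fun _ hω h =>
    hu.not_ge (le_of_mem_renewalCountSet hω h)

theorem measure_mem_renewalCountSet_zero (hJ : IsInterarrivalSequence lam ν J P) (hlam : 0 < lam)
    (hν : 0 < ν) (hν1 : ν ≤ 1) {u : ℝ} (hu : 0 < u) :
    P {ω | (fun i => J i ω) ∈ renewalCountSet u 0} =
      ENNReal.ofReal (countProbability lam ν 0 u) := by
  have := hJ.isProbabilityMeasure_mittagLefflerLaw
  simp only [mem_renewalCountSet_zero, hu.le, true_and]
  rw [← mittagLefflerLaw_Ioi hlam hν hν1 hu, ← (hJ.hasLaw 0).map_eq,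
    Measure.map_apply (hJ.measurable 0) measurableSet_Ioi]
  rfl

theorem measure_mem_renewalCountSet (hJ : IsInterarrivalSequence lam ν J P) (hlam : 0 < lam)
    (hν : 0 < ν) (hν1 : ν ≤ 1) (m : ℕ) {u : ℝ} (hu : 0 < u) :
    P {ω | (fun i => J i ω) ∈ renewalCountSet u m} =
      ENNReal.ofReal (countProbability lam ν m u) := by
  rcases m.eq_zero_or_pos with rfl | hm
  · exact hJ.measure_mem_renewalCountSet_zero hlam hν hν1 hu
  obtain ⟨hint, hval⟩ := eventTimeDensity_countProbability_convolution hν hm 0 hu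
  calc P {ω | (fun i => J i ω) ∈ renewalCountSet u m}
      = P {ω | (eventTime J m ω, fun i => J (m + i) ω) ∈
          {p : ℝ × (ℕ → ℝ) | p.2 ∈ renewalCountSet (u - p.1) 0}} :=
        congrArg P (Set.ext fun ω => mem_renewalCountSet_add (m := 0))
    _ = ∫⁻ w in Set.Ioo 0 u,
          ENNReal.ofReal (eventTimeDensity lam ν m w * countProbability lam ν 0 (u - w)) := by
        refine hJ.measure_eventTime_shift_mem hlam hν hν1 hm
          (measurableSet_mem_renewalCountSet (by fun_prop) measurable_snd 0) le_rfl
          (fun w hw0 hw => ?_) (fun w hw => ?_)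
        · have hwu : u < w := not_le.1 fun h => hw ⟨hw0.le, h⟩
          exact (hJ.shift m).measure_mem_renewalCountSet_of_neg (sub_neg.2 hwu) 0
        · exact (hJ.shift m).measure_mem_renewalCountSet_zero hlam hν hν1 (sub_pos.2 hw.2)
    _ = ENNReal.ofReal (countProbability lam ν m u) := by
        rw [lintegral_ofReal_Ioo_eq_ofReal_intervalIntegral hu.le hint fun y hy => mul_nonneg
          (eventTimeDensity_nonneg hlam hν hν1 hm hy.1)
          (countProbability_nonneg hlam hν hν1 0 (sub_pos.2 hy.2)), hval, add_zero]

theorem measure_mem_renewalCountSet_zero_inter (hJ : IsInterarrivalSequence lam ν J P)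
    (hlam : 0 < lam) (hν : 0 < ν) (hν1 : ν ≤ 1) (m : ℕ) {s t : ℝ} (hs : 0 ≤ s) (hst : s ≤ t) :
    P {ω | (fun i => J i ω) ∈ renewalCountSet s 0 ∩ renewalCountSet t (1 + m)} =
      ENNReal.ofReal (delayedCountProbability lam ν m s t) := by
  let A : Set (ℝ × (ℕ → ℝ)) := {p | s < p.1 ∧ p.2 ∈ renewalCountSet (t - p.1) m}
  have hA : MeasurableSet A := (measurableSet_lt measurable_const measurable_fst).inter
    (measurableSet_mem_renewalCountSet (by fun_prop) measurable_snd m)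
  have hset : {ω | (fun i => J i ω) ∈ renewalCountSet s 0 ∩ renewalCountSet t (1 + m)} =
      {ω | (eventTime J 1 ω, fun i => J (1 + i) ω) ∈ A} := by
    ext ω
    simp [A, mem_renewalCountSet_zero, mem_renewalCountSet_add, eventTime, hs]
  rw [hset, delayedCountProbability, ← lintegral_ofReal_Ioo_eq_ofReal_intervalIntegral hst
    (intervalIntegrable_eventTimeDensity_mul_countProbability hν le_rfl m hs hst)
    fun y hy => mul_nonneg (eventTimeDensity_nonneg hlam hν hν1 le_rfl (hs.trans_lt hy.1))
      (countProbability_nonneg hlam hν hν1 m (sub_pos.2 hy.2))]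
  refine hJ.measure_eventTime_shift_mem hlam hν hν1 le_rfl hA hs (fun y _ hy => ?_) fun y hy => ?_
  · rcases le_or_gt y s with hys | hsy
    · simp [A, hys.not_gt]
    · have hty : t < y := not_le.1 fun h => hy ⟨hsy.le, h⟩
      simpa [A, hsy] using (hJ.shift 1).measure_mem_renewalCountSet_of_neg (sub_neg.2 hty) m
  · simpa [A, hy.1] using
      (hJ.shift 1).measure_mem_renewalCountSet hlam hν hν1 m (sub_pos.2 hy.2)

theorem measure_mem_renewalCountSet_inter (hJ : IsInterarrivalSequence lam ν J P)
    (hlam : 0 < lam) (hν : 0 < ν) (hν1 : ν ≤ 1) {k : ℕ} (hk : 1 ≤ k) (m : ℕ) {s t : ℝ}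
    (hst : s ≤ t) :
    P {ω | (fun i => J i ω) ∈ renewalCountSet s k ∩ renewalCountSet t (k + (1 + m))} =
      ∫⁻ w in Set.Ioo 0 s, ENNReal.ofReal
        (eventTimeDensity lam ν k w * delayedCountProbability lam ν m (s - w) (t - w)) := by
  let A : Set (ℝ × (ℕ → ℝ)) :=
    {p | p.2 ∈ renewalCountSet (s - p.1) 0 ∩ renewalCountSet (t - p.1) (1 + m)}
  have hA : MeasurableSet A :=
    (measurableSet_mem_renewalCountSet (by fun_prop) measurable_snd 0).inter
      (measurableSet_mem_renewalCountSet (by fun_prop) measurable_snd (1 + m))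
  have hset : {ω | (fun i => J i ω) ∈ renewalCountSet s k ∩ renewalCountSet t (k + (1 + m))} =
      {ω | (eventTime J k ω, fun i => J (k + i) ω) ∈ A} :=
    Set.ext fun ω => and_congr (mem_renewalCountSet_add (m := 0)) mem_renewalCountSet_add
  rw [hset]
  refine hJ.measure_eventTime_shift_mem hlam hν hν1 hk hA le_rfl (fun w hw0 hw => ?_) fun w hw => ?_
  · have hsw : s < w := not_le.1 fun h => hw ⟨hw0.le, h⟩
    exact measure_mono_null (fun ω h => h.1)
      ((hJ.shift k).measure_mem_renewalCountSet_of_neg (sub_neg.2 hsw) 0)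
  · exact (hJ.shift k).measure_mem_renewalCountSet_zero_inter hlam hν hν1 m
      (sub_nonneg.2 hw.2.le) (sub_le_sub_right hst w)

theorem measure_count_eq_and_count_eq (hJ : IsInterarrivalSequence lam ν J P) {N : ℝ → Ω → ℕ}
    (hcount : ∀ᵐ ω ∂P, ∀ t : ℝ, 0 ≤ t →
      (N t ω : ℕ∞) = Set.encard {n : ℕ | 1 ≤ n ∧ eventTime J n ω ≤ t})
    {s t : ℝ} (hs : 0 ≤ s) (ht : 0 ≤ t) (k r : ℕ) :
    P {ω | N s ω = k ∧ N t ω = r} =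
      P {ω | (fun i => J i ω) ∈ renewalCountSet s k ∩ renewalCountSet t r} := by
  refine measure_congr ?_
  filter_upwards [hcount, hJ.ae_pos] with ω hω hpos
  refine propext (and_congr ?_ ?_)
  · rw [← encard_setOf_sum_range_le_eq_iff hpos hs, ← Nat.cast_inj (R := ℕ∞), hω s hs]
    rfl
  · rw [← encard_setOf_sum_range_le_eq_iff hpos ht, ← Nat.cast_inj (R := ℕ∞), hω t ht]
    rfl

end IsInterarrivalSequence

theorem intervalIntegrable_and_toReal_eq_of_lintegral_Ioo_ne_top {f : ℝ → ℝ} {a b : ℝ}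
    (hab : a ≤ b) (hf : Measurable f) (hf0 : ∀ x ∈ Set.Ioo a b, 0 ≤ f x)
    (hfin : ∫⁻ x in Set.Ioo a b, ENNReal.ofReal (f x) ≠ ⊤) :
    IntervalIntegrable f volume a b ∧
      (∫⁻ x in Set.Ioo a b, ENNReal.ofReal (f x)).toReal = ∫ x in a..b, f x := by
  have hf0' : 0 ≤ᵐ[volume.restrict (Set.Ioo a b)] f :=
    (ae_restrict_mem measurableSet_Ioo).mono hf0
  refine ⟨(intervalIntegrable_iff_integrableOn_Ioo_of_le hab).2 ?_, ?_⟩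
  · exact (lintegral_ofReal_ne_top_iff_integrable hf.aestronglyMeasurable hf0').1 hfin
  · rw [intervalIntegral_eq_integral_Ioo hab,
      integral_eq_lintegral_of_nonneg_ae hf0' hf.aestronglyMeasurable]

theorem IsFractionalPoissonProcess.intervalIntegrable_and_measureReal_eq {Ω : Type*}
    [MeasurableSpace Ω] {P : Measure Ω} {lam ν : ℝ} {N : ℝ → Ω → ℕ}
    (hN : IsFractionalPoissonProcess lam ν N P) (hlam : 0 < lam) (hν : 0 < ν) (hν1 : ν ≤ 1)
    {k : ℕ} (hk : 1 ≤ k) (m : ℕ) {s t : ℝ} (hs : 0 ≤ s) (hst : s ≤ t) :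
    IntervalIntegrable (fun w => eventTimeDensity lam ν k w *
        delayedCountProbability lam ν m (s - w) (t - w)) volume 0 s ∧
      P.real {ω | N s ω = k ∧ N t ω = k + (1 + m)} =
        ∫ w in (0 : ℝ)..s, eventTimeDensity lam ν k w *
          delayedCountProbability lam ν m (s - w) (t - w) := by
  obtain ⟨J, hJ, hcount⟩ := hN.exists_isInterarrivalSequence
  have := hJ.isProbabilityMeasure
  have hP : P {ω | N s ω = k ∧ N t ω = k + (1 + m)} = ∫⁻ w in Set.Ioo 0 s, ENNReal.ofReal
      (eventTimeDensity lam ν k w * delayedCountProbability lam ν m (s - w) (t - w)) := by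
    rw [hJ.measure_count_eq_and_count_eq hcount hs (hs.trans hst),
      hJ.measure_mem_renewalCountSet_inter hlam hν hν1 hk m hst]
  rw [measureReal_def, hP]
  refine intervalIntegrable_and_toReal_eq_of_lintegral_Ioo_ne_top hs
    ((measurable_eventTimeDensity hν hk).mul (measurable_delayedCountProbability hν m hst))
    (fun w hw => ?_) (hP ▸ measure_ne_top P _)
  exact mul_nonneg (eventTimeDensity_nonneg hlam hν hν1 hk hw.1)
    (delayedCountProbability_nonneg hlam hν hν1 m (sub_nonneg.2 hw.2.le) (sub_le_sub_right hst w))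

section Integrands

variable {lam : ℝ}

theorem prabhakar_integrand_eq_eventTimeDensity_mul_countProbability (hlam : lam ≠ 0) (ν : ℝ)
    (m : ℕ) (y u : ℝ) :
    y ^ (ν - 1) * mittagLeffler ν ν (-lam * y ^ ν) * u ^ (ν * m) *
        prabhakar (m + 1) ν (ν * m + 1) (-lam * u ^ ν) =
      (lam ^ (1 + m))⁻¹ * (eventTimeDensity lam ν 1 y * countProbability lam ν m u) := by
  rw [eq_inv_mul_iff_mul_eq₀ (pow_ne_zero _ hlam)]
  simp only [eventTimeDensity, countProbability, mittagLeffler, Nat.cast_one, mul_one, pow_add]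
  ring

theorem prabhakar_integrand_eq_eventTimeDensity_mul_delayedCountProbability (hlam : lam ≠ 0)
    (ν : ℝ) (k m : ℕ) (w s t : ℝ) :
    w ^ (ν * k - 1) * prabhakar k ν (ν * k) (-lam * w ^ ν) *
        ∫ y in s..t, y ^ (ν - 1) * mittagLeffler ν ν (-lam * y ^ ν) * (t - y) ^ (ν * m) *
          prabhakar (m + 1) ν (ν * m + 1) (-lam * (t - y) ^ ν) =
      (lam ^ (k + (1 + m)))⁻¹ *
        (eventTimeDensity lam ν k w * delayedCountProbability lam ν m s t) := by
  simp only [prabhakar_integrand_eq_eventTimeDensity_mul_countProbability hlam,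
    intervalIntegral.integral_const_mul]
  rw [← delayedCountProbability, eventTimeDensity, pow_add lam k, mul_inv]
  have hk : lam ^ k ≠ 0 := pow_ne_zero k hlam
  field_simp

end Integrands

theorem mainTheorem1 {Ω : Type*} [MeasurableSpace Ω] (P : Measure Ω) [IsProbabilityMeasure P]
    (lam ν : ℝ) (hlam : 0 < lam) (hν0 : 0 < ν) (hν1 : ν ≤ 1)
    (N : ℝ → Ω → ℕ) (hN : IsFractionalPoissonProcess lam ν N P)
    (s t : ℝ) (hs : 0 ≤ s) (hst : s ≤ t) (k r : ℕ) (hk : 1 ≤ k) (hkr : k < r) :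
    -- the inner integrals converge
    (∀ w ∈ Set.Icc 0 s, IntervalIntegrable
      (fun y : ℝ => y ^ (ν - 1) * mittagLeffler ν ν (-lam * y ^ ν) *
        (t - w - y) ^ (ν * ((r : ℝ) - k - 1)) *
        prabhakar ((r : ℝ) - k) ν (ν * ((r : ℝ) - k - 1) + 1) (-lam * (t - w - y) ^ ν))
      volume (s - w) (t - w)) ∧
    -- the outer integral converges
    IntervalIntegrable
      (fun w : ℝ => w ^ (ν * k - 1) * prabhakar k ν (ν * k) (-lam * w ^ ν) *
        ∫ y in (s - w)..(t - w), y ^ (ν - 1) * mittagLeffler ν ν (-lam * y ^ ν) *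
          (t - w - y) ^ (ν * ((r : ℝ) - k - 1)) *
          prabhakar ((r : ℝ) - k) ν (ν * ((r : ℝ) - k - 1) + 1) (-lam * (t - w - y) ^ ν))
      volume 0 s ∧
    P.real {ω | N s ω = k ∧ N t ω = r} =
      lam ^ r * ∫ w in (0 : ℝ)..s, w ^ (ν * k - 1) * prabhakar k ν (ν * k) (-lam * w ^ ν) *
        ∫ y in (s - w)..(t - w), y ^ (ν - 1) * mittagLeffler ν ν (-lam * y ^ ν) *
          (t - w - y) ^ (ν * ((r : ℝ) - k - 1)) *
          prabhakar ((r : ℝ) - k) ν (ν * ((r : ℝ) - k - 1) + 1) (-lam * (t - w - y) ^ ν) := by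
  obtain ⟨m, rfl⟩ : ∃ m, r = k + (1 + m) :=
    (Nat.exists_eq_add_of_le (Nat.succ_le_of_lt hkr)).imp fun m hm => hm.trans (add_assoc k 1 m)
  have hsub : ((k + (1 + m) : ℕ) : ℝ) - k = m + 1 := by push_cast; ring
  obtain ⟨hint, hprob⟩ := hN.intervalIntegrable_and_measureReal_eq hlam hν0 hν1 hk m hs hst
  simp only [hsub, add_sub_cancel_right,
    prabhakar_integrand_eq_eventTimeDensity_mul_delayedCountProbability hlam.ne']
  refine ⟨fun w hw => ?_, hint.const_mul _, ?_⟩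
  · simp only [prabhakar_integrand_eq_eventTimeDensity_mul_countProbability hlam.ne']
    exact (intervalIntegrable_eventTimeDensity_mul_countProbability hν0 le_rfl m
      (sub_nonneg.2 hw.2) (sub_le_sub_right hst w)).const_mul _
  · rw [hprob, intervalIntegral.integral_const_mul, mul_inv_cancel_left₀ (by positivity)]
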